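/- Let $d\ge 1$, let $\Omega\subset\mathbb R^d$ be a bounded open set with boundary $\Gamma=\partial\Omega$, and assume $\sigma(\Gamma)<\infty$, where $\sigma=\mathcal H^{d-1}$ is the $(d-1)$-dimensional Hausdorff measure. All function spaces are complex; $L^2(\Gamma)=L^2(\Gamma,\sigma)$. Let $\beta\in L^\infty(\Gamma)$ be complex-valued. For $u\in H^1(\Omega)$, a function $\varphi\in L^2(\Gamma)$ is an (approximative) trace of $u$, written $\varphi\in\operatorname{Tr}(u)$, if there are $u_n\in C(\overline\Omega)\cap H^1(\Omega)$ with $u_n\to u$ in $H^1(\Omega)$ and $u_n|_\Gamma\to\varphi$ in $L^2(\Gamma)$. For $u\in H^1(\Omega)$ with distributional Laplacian $\Delta u\in L^2(\Omega)$ and $h\in L^2(\Gamma)$, write $\partial_\nu u=h$ if $$\int_\Omega(\Delta u)\overline v+\int_\Omega\nabla u\cdot\overline{\nabla v}=\int_\Gamma h\overline v\,d\sigma\qquad\text{for all }v\in C(\overline\Omega)\cap H^1(\Omega),$$ and $\partial_\nu u\in L^2(\Gamma)$ if such an $h$ exists. Then $$D(\Delta^{\mathrm W})=\{(u,\varphi)\in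 H^1(\Omega)\oplus L^2(\Gamma):\Delta u\in L^2(\Omega),\ \varphi\in\operatorname{Tr}(u),\ \partial_\nu u\in L^2(\Gamma)\},\qquad \Delta^{\mathrm W}(u,\varphi)=(\Delta u,\,-\partial_\nu u-\beta\varphi)$$ is a well-defined linear operator in the Hilbert space $H=L^2(\Omega)\oplus L^2(\Gamma)$, and it generates a holomorphic $C_0$-semigroup on $H$. Moreover, let $D(a)=C(\overline\Omega)\cap H^1(\Omega)$, $a(u,v)=\int_\Omega\nabla u\cdot\overline{\nabla v}+\int_\Gamma\beta u\overline v\,d\sigma$ for $u,v\in D(a)$, and $j\colon D(a)\to H$, $j(u)=(u,u|_\Gamma)$. Then $(a,j)$ is a (not necessarily closable) sectorial form in $H$, that is, $j$ has dense range and there are $\omega\in\mathbb R$ and $\theta\in[0,\pi/2)$ such that $a(u,u)+\omega\|j(u)\|_H^2\in\{re^{i\alpha}:r\ge0,\ |\alpha|\le\theta\}$ for all $u\in D(a)$. The operator $-\Delta^{\mathrm W}$ is associated with $(a,j)$: for $x,y\in H$ one has $x\in D(\Delta^{\mathrm W})$ and $-\Delta^{\mathrm W}x=y$ if and only if there is a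 sequence $(u_n)$ in $D(a)$ with $j(u_n)\to x$ in $H$, $a(u_n-u_m,u_n-u_m)\to0$ as $n,m\to\infty$, and $a(u_n,v)\to\langle y,j(v)\rangle_H$ for all $v\in D(a)$. -/

import Mathlib

open MeasureTheory Filter Topology TopologicalSpace
open scoped ENNReal NNReal Distributions ComplexConjugate InnerProductSpace

noncomputable section

namespace Wentzell

/-! ### Holomorphic `C₀`-semigroups and their generators -/

section Semigroup

variable {H : Type*} [NormedAddCommGroup H] [NormedSpace ℂ H]

/-- `C₀`-semigroups of bounded operators. -/
structure IsC0Semigroup (S : ℝ≥0 → H →L[ℂ] H) : Prop where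
  map_zero : S 0 = ContinuousLinearMap.id ℂ H
  map_add : ∀ s t, S (s + t) = (S s).comp (S t)
  tendsto_zero : ∀ x, Tendsto (fun t => S t x) (𝓝 0) (𝓝 x)

/-- The open sector of half-angle `θ` around the positive real axis. -/
def openSector (θ : ℝ) : Set ℂ := {z | z ≠ 0 ∧ |Complex.arg z| < θ}

/-- A `C₀`-semigroup is holomorphic if, for some `θ ∈ (0, π/2]`, it has a holomorphic extension to
the open sector of half-angle `θ` which is bounded near `0` on every smaller sector. -/
def IsHolomorphicC0Semigroup (S : ℝ≥0 → H →L[ℂ] H) : Prop :=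
  IsC0Semigroup S ∧
    ∃ θ : ℝ, 0 < θ ∧ θ ≤ Real.pi / 2 ∧ ∃ F : ℂ → H →L[ℂ] H,
      DifferentiableOn ℂ F (openSector θ) ∧
      (∀ t : ℝ≥0, 0 < t → F ((t : ℝ) : ℂ) = S t) ∧
      ∀ θ' : ℝ, 0 < θ' → θ' < θ → ∃ M : ℝ, ∀ z ∈ openSector θ', ‖z‖ ≤ 1 → ‖F z‖ ≤ M

/-- `A` is the (infinitesimal) generator of `S`, domain included. -/
def IsGenerator (A : H →ₗ.[ℂ] H) (S : ℝ≥0 → H →L[ℂ] H) : Prop :=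
  ∀ x y : H, (x, y) ∈ A.graph ↔
    Tendsto (fun t : ℝ≥0 => ((t : ℝ) : ℂ)⁻¹ • (S t x - x)) (𝓝[>] 0) (𝓝 y)

end Semigroup

/-! ### Sectorial forms and the associated operator -/

section Form

variable {V H : Type*} [AddCommGroup V] [Module ℂ V] [NormedAddCommGroup H] [InnerProductSpace ℂ H]

/-- The closed sector `{r e^{iα} : r ≥ 0, |α| ≤ θ}`. -/
def closedSector (θ : ℝ) : Set ℂ :=
  {z | ∃ r α : ℝ, 0 ≤ r ∧ |α| ≤ θ ∧ z = (r : ℂ) * Complex.exp ((α : ℂ) * Complex.I)}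

/-- `(a, j)` is a sectorial form in `H`; `a` is linear in its first argument and antilinear in
its second. No closability or completeness is required. -/
def IsSectorialForm (a : V →ₗ[ℂ] V →ₛₗ[starRingEnd ℂ] ℂ) (j : V →ₗ[ℂ] H) : Prop :=
  DenseRange j ∧ ∃ ω θ : ℝ, 0 ≤ θ ∧ θ < Real.pi / 2 ∧
    ∀ u : V, a u u + ((ω * ‖j u‖ ^ 2 : ℝ) : ℂ) ∈ closedSector θ

/-- The graph of the operator associated with `(a, j)`: `x ∈ D(A)` and `A x = y`. Mathlib's inner
product is antilinear in its first argument, so `⟪j v, y⟫_ℂ` is the scalar product of `y` with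
`j v` that is linear in `y`. -/
def FormOperatorRel (a : V →ₗ[ℂ] V →ₛₗ[starRingEnd ℂ] ℂ) (j : V →ₗ[ℂ] H) (x y : H) : Prop :=
  ∃ u : ℕ → V,
    Tendsto (fun n => j (u n)) atTop (𝓝 x) ∧
    Tendsto (fun p : ℕ × ℕ => a (u p.1 - u p.2) (u p.1 - u p.2)) atTop (𝓝 0) ∧
    ∀ v : V, Tendsto (fun n => a (u n) v) atTop (𝓝 ⟪j v, y⟫_ℂ)

/-- The sesquilinear form `(u, v) ↦ (f u | g v)`, linear in `u` and antilinear in `v`. -/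
def innerForm (f g : V →ₗ[ℂ] H) : V →ₗ[ℂ] V →ₛₗ[starRingEnd ℂ] ℂ :=
  LinearMap.mk₂'ₛₗ (RingHom.id ℂ) (starRingEnd ℂ) (fun u v => ⟪g v, f u⟫_ℂ)
    (fun u u' v => by rw [map_add, inner_add_right])
    (fun c u v => by rw [map_smul, inner_smul_right]; rfl)
    (fun u v v' => by rw [map_add, inner_add_left])
    (fun c u v => by rw [map_smul, inner_smul_left]; rfl)

end Form

/-! ### Function spaces on an open set and on its boundary -/

variable {d : ℕ}

/-- Lebesgue measure on `Ω`. -/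
abbrev volΩ (Ω : Opens (EuclideanSpace ℝ (Fin d))) : Measure (EuclideanSpace ℝ (Fin d)) :=
  volume.restrict (Ω : Set (EuclideanSpace ℝ (Fin d)))

/-- The `(d-1)`-dimensional Hausdorff measure `σ` (normalised to agree with surface measure) on the
boundary `Γ = ∂Ω`. -/
abbrev σΓ (Ω : Opens (EuclideanSpace ℝ (Fin d))) : Measure (EuclideanSpace ℝ (Fin d)) :=
  (μHE[d - 1] : Measure (EuclideanSpace ℝ (Fin d))).restrict
    (frontier (Ω : Set (EuclideanSpace ℝ (Fin d))))

/-- `L²(Ω)`, complex-valued. -/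
abbrev L2Ω (Ω : Opens (EuclideanSpace ℝ (Fin d))) : Type := Lp ℂ 2 (volΩ Ω)

/-- `L²(Γ)`, complex-valued. -/
abbrev L2Γ (Ω : Opens (EuclideanSpace ℝ (Fin d))) : Type := Lp ℂ 2 (σΓ Ω)

/-- `L^∞(Γ)`, complex-valued. -/
abbrev LinfΓ (Ω : Opens (EuclideanSpace ℝ (Fin d))) : Type := Lp ℂ ∞ (σΓ Ω)

/-- The Hilbert space direct sum `L²(Ω) ⊕ L²(Γ)`. -/
abbrev HSum (Ω : Opens (EuclideanSpace ℝ (Fin d))) : Type := WithLp 2 (L2Ω Ω × L2Γ Ω)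

/-- The Hilbert space `L²(Ω) ⊕ L²(Ω)^d`. -/
abbrev L2Jet (Ω : Opens (EuclideanSpace ℝ (Fin d))) : Type :=
  WithLp 2 (L2Ω Ω × PiLp 2 (fun _ : Fin d => L2Ω Ω))

/-- `g = ∂ᵢ u` in the sense of distributions on `Ω`. -/
def HasWeakPartial (Ω : Opens (EuclideanSpace ℝ (Fin d))) (i : Fin d) (u g : L2Ω Ω) : Prop :=
  ∀ φ : 𝓓(Ω, ℂ),
    ∫ x in (Ω : Set (EuclideanSpace ℝ (Fin d))),
        u x * fderiv ℝ (φ : EuclideanSpace ℝ (Fin d) → ℂ) x (EuclideanSpace.single i 1) =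
      -∫ x in (Ω : Set (EuclideanSpace ℝ (Fin d))), g x * φ x

/-- `f = Δ u` in the sense of distributions on `Ω`. -/
def HasWeakLaplacian (Ω : Opens (EuclideanSpace ℝ (Fin d))) (u f : L2Ω Ω) : Prop :=
  ∀ φ : 𝓓(Ω, ℂ),
    ∫ x in (Ω : Set (EuclideanSpace ℝ (Fin d))),
        u x * Laplacian.laplacian (φ : EuclideanSpace ℝ (Fin d) → ℂ) x =
      ∫ x in (Ω : Set (EuclideanSpace ℝ (Fin d))), f x * φ x

lemma integrable_mul_testFunction (Ω : Opens (EuclideanSpace ℝ (Fin d))) (u : L2Ω Ω)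
    (φ : 𝓓(Ω, ℂ)) : Integrable (fun x => u x * φ x) (volΩ Ω) :=
  (Lp.memLp u).integrable_mul (q := 2)
    (φ.continuous.memLp_of_hasCompactSupport φ.hasCompactSupport)

lemma integrable_mul_fderiv_testFunction (Ω : Opens (EuclideanSpace ℝ (Fin d))) (u : L2Ω Ω)
    (φ : 𝓓(Ω, ℂ)) (v : EuclideanSpace ℝ (Fin d)) :
    Integrable (fun x => u x * fderiv ℝ (φ : EuclideanSpace ℝ (Fin d) → ℂ) x v) (volΩ Ω) := by
  have hc : Continuous fun x => fderiv ℝ (φ : EuclideanSpace ℝ (Fin d) → ℂ) x v :=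
    (φ.contDiff.continuous_fderiv (by simp)).clm_apply continuous_const
  exact (Lp.memLp u).integrable_mul (q := 2)
    (hc.memLp_of_hasCompactSupport (φ.hasCompactSupport.fderiv_apply ℝ v))

lemma HasWeakPartial.add {Ω : Opens (EuclideanSpace ℝ (Fin d))} {i : Fin d} {u g u' g' : L2Ω Ω}
    (h : HasWeakPartial Ω i u g) (h' : HasWeakPartial Ω i u' g') :
    HasWeakPartial Ω i (u + u') (g + g') := by
  intro φ
  have e1 : ∫ x in (Ω : Set (EuclideanSpace ℝ (Fin d))), (u + u' : L2Ω Ω) x *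
      fderiv ℝ (φ : EuclideanSpace ℝ (Fin d) → ℂ) x (EuclideanSpace.single i 1) = _ :=
    (integral_congr_ae (by
      filter_upwards [Lp.coeFn_add u u'] with x hx
      rw [hx, Pi.add_apply, add_mul])).trans
    (integral_add (integrable_mul_fderiv_testFunction Ω u φ _)
      (integrable_mul_fderiv_testFunction Ω u' φ _))
  have e2 : ∫ x in (Ω : Set (EuclideanSpace ℝ (Fin d))), (g + g' : L2Ω Ω) x * φ x = _ :=
    (integral_congr_ae (by
      filter_upwards [Lp.coeFn_add g g'] with x hx
      rw [hx, Pi.add_apply, add_mul])).trans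
    (integral_add (integrable_mul_testFunction Ω g φ) (integrable_mul_testFunction Ω g' φ))
  rw [e1, e2, h φ, h' φ]
  ring

lemma HasWeakPartial.smul {Ω : Opens (EuclideanSpace ℝ (Fin d))} {i : Fin d} {u g : L2Ω Ω}
    (c : ℂ) (h : HasWeakPartial Ω i u g) : HasWeakPartial Ω i (c • u) (c • g) := by
  intro φ
  have e1 : ∫ x in (Ω : Set (EuclideanSpace ℝ (Fin d))), (c • u : L2Ω Ω) x *
      fderiv ℝ (φ : EuclideanSpace ℝ (Fin d) → ℂ) x (EuclideanSpace.single i 1) = _ :=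
    (integral_congr_ae (by
      filter_upwards [Lp.coeFn_smul c u] with x hx
      rw [hx, Pi.smul_apply, smul_eq_mul, mul_assoc])).trans
    (integral_const_mul c _)
  have e2 : ∫ x in (Ω : Set (EuclideanSpace ℝ (Fin d))), (c • g : L2Ω Ω) x * φ x = _ :=
    (integral_congr_ae (by
      filter_upwards [Lp.coeFn_smul c g] with x hx
      rw [hx, Pi.smul_apply, smul_eq_mul, mul_assoc])).trans
    (integral_const_mul c _)
  rw [e1, e2, h φ]
  ring

lemma HasWeakPartial.zero (Ω : Opens (EuclideanSpace ℝ (Fin d))) (i : Fin d) :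
    HasWeakPartial Ω i 0 0 := by
  intro φ
  rw [integral_eq_zero_of_ae, integral_eq_zero_of_ae, neg_zero]
  all_goals
    filter_upwards [Lp.coeFn_zero ℂ 2 (volΩ Ω)] with x hx
    simp only [hx, Pi.zero_apply, zero_mul]

/-- The Sobolev space `H¹(Ω)`. Since the weak gradient of `u` is unique, `u` is
recorded together with it, as the pair `(u, ∇u)` in `L²(Ω) ⊕ L²(Ω)^d`; the norm inherited from there
is the usual norm of `H¹(Ω)`. -/
def H1 (Ω : Opens (EuclideanSpace ℝ (Fin d))) : Submodule ℂ (L2Jet Ω) where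
  carrier := {p | ∀ i, HasWeakPartial Ω i p.fst (p.snd i)}
  add_mem' hp hq i := (hp i).add (hq i)
  zero_mem' i := HasWeakPartial.zero Ω i
  smul_mem' c _ hp i := (hp i).smul c

instance (Ω : Opens (EuclideanSpace ℝ (Fin d))) : AddCommGroup (H1 Ω) :=
  Submodule.addCommGroup (H1 Ω)

instance (Ω : Opens (EuclideanSpace ℝ (Fin d))) : Module ℂ (H1 Ω) :=
  Submodule.module (H1 Ω)

namespace H1

variable {Ω : Opens (EuclideanSpace ℝ (Fin d))}

/-- The function underlying an element of `H¹(Ω)`. -/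
def toL2 : H1 Ω →ₗ[ℂ] L2Ω Ω where
  toFun u := (u : L2Jet Ω).fst
  map_add' _ _ := rfl
  map_smul' _ _ := rfl

/-- The weak gradient of an element of `H¹(Ω)`. -/
def grad : H1 Ω →ₗ[ℂ] PiLp 2 (fun _ : Fin d => L2Ω Ω) where
  toFun u := (u : L2Jet Ω).snd
  map_add' _ _ := rfl
  map_smul' _ _ := rfl

end H1

/-- The space `C(Ω̄) ∩ H¹(Ω)`. A function `w ∈ C(Ω̄)` in this space is recorded as
`(w, u, ψ)`, where `u ∈ H¹(Ω)` is `w` on `Ω` and `ψ ∈ L²(Γ)` is the class of the restriction `w|_Γ`.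
Both `u` and `ψ` are determined by `w` (and `w` by `u`); for bounded `Ω` with `σ(Γ) < ∞` every
`w ∈ C(Ω̄)` has `w|_Γ ∈ L²(Γ)`, so that `ψ` is no restriction. -/
def ContH1 (Ω : Opens (EuclideanSpace ℝ (Fin d))) :
    Submodule ℂ (C(closure (Ω : Set (EuclideanSpace ℝ (Fin d))), ℂ) × H1 Ω × L2Γ Ω) where
  carrier := {p |
    (∀ᵐ x ∂(volΩ Ω), ∀ hx : x ∈ closure (Ω : Set (EuclideanSpace ℝ (Fin d))),
      H1.toL2 p.2.1 x = p.1 ⟨x, hx⟩) ∧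
    (∀ᵐ x ∂(σΓ Ω), ∀ hx : x ∈ closure (Ω : Set (EuclideanSpace ℝ (Fin d))),
      p.2.2 x = p.1 ⟨x, hx⟩)}
  add_mem' {p q} hp hq := by
    refine ⟨?_, ?_⟩
    · filter_upwards [hp.1, hq.1, Lp.coeFn_add (H1.toL2 p.2.1) (H1.toL2 q.2.1)] with x h1 h2 h3 hx
      exact h3.trans (congrArg₂ (· + ·) (h1 hx) (h2 hx))
    · filter_upwards [hp.2, hq.2, Lp.coeFn_add p.2.2 q.2.2] with x h1 h2 h3 hx
      exact h3.trans (congrArg₂ (· + ·) (h1 hx) (h2 hx))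
  zero_mem' := by
    refine ⟨?_, ?_⟩
    · filter_upwards [Lp.coeFn_zero ℂ 2 (volΩ Ω)] with x h3 hx
      exact h3
    · filter_upwards [Lp.coeFn_zero ℂ 2 (σΓ Ω)] with x h3 hx
      exact h3
  smul_mem' c p hp := by
    refine ⟨?_, ?_⟩
    · filter_upwards [hp.1, Lp.coeFn_smul c (H1.toL2 p.2.1)] with x h1 h3 hx
      exact h3.trans (congrArg (c * ·) (h1 hx))
    · filter_upwards [hp.2, Lp.coeFn_smul c p.2.2] with x h1 h3 hx
      exact h3.trans (congrArg (c * ·) (h1 hx))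

instance (Ω : Opens (EuclideanSpace ℝ (Fin d))) : AddCommGroup (ContH1 Ω) :=
  Submodule.addCommGroup (ContH1 Ω)

instance (Ω : Opens (EuclideanSpace ℝ (Fin d))) : Module ℂ (ContH1 Ω) :=
  Submodule.module (ContH1 Ω)

namespace ContH1

variable {Ω : Opens (EuclideanSpace ℝ (Fin d))}

/-- A function in `C(Ω̄) ∩ H¹(Ω)` as an element of `H¹(Ω)`. -/
def toH1 : ContH1 Ω →ₗ[ℂ] H1 Ω where
  toFun v := v.1.2.1
  map_add' _ _ := rfl
  map_smul' _ _ := rfl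

/-- The restriction `v|_Γ` as an element of `L²(Γ)`. -/
def onΓ : ContH1 Ω →ₗ[ℂ] L2Γ Ω where
  toFun v := v.1.2.2
  map_add' _ _ := rfl
  map_smul' _ _ := rfl

/-- The gradient of a function in `C(Ω̄) ∩ H¹(Ω)`. -/
def grad : ContH1 Ω →ₗ[ℂ] PiLp 2 (fun _ : Fin d => L2Ω Ω) :=
  (H1.grad (Ω := Ω)).comp (toH1 (Ω := Ω))

end ContH1

/-! ### Traces, normal derivatives and the Wentzell Laplacian -/

section Operator

variable (Ω : Opens (EuclideanSpace ℝ (Fin d)))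

/-- `φ ∈ Tr(u)`: `φ` is an approximative trace of `u`. -/
def IsApproxTrace (u : H1 Ω) (φ : L2Γ Ω) : Prop :=
  ∃ w : ℕ → ContH1 Ω,
    Tendsto (fun n => ContH1.toH1 (w n)) atTop (𝓝 u) ∧ Tendsto (fun n => ContH1.onΓ (w n)) atTop (𝓝 φ)

/-- `∂_ν u = h`, where `f = Δ u`: Green's formula
`∫_Ω f v̄ + ∫_Ω ∇u · ∇v̄ = ∫_Γ h v̄` for all `v ∈ C(Ω̄) ∩ H¹(Ω)`. -/
def IsNormalDeriv (u : H1 Ω) (f : L2Ω Ω) (h : L2Γ Ω) : Prop :=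
  ∀ v : ContH1 Ω, ⟪H1.toL2 (ContH1.toH1 v), f⟫_ℂ + ⟪H1.grad (ContH1.toH1 v), H1.grad u⟫_ℂ = ⟪ContH1.onΓ v, h⟫_ℂ

/-- The graph of `Δ^W`: `(u, φ) = x` is in the domain and `Δ^W x = y`, that is,
`u ∈ H¹(Ω)`, `Δu ∈ L²(Ω)`, `φ ∈ Tr(u)`, `∂_ν u = h ∈ L²(Γ)` and `y = (Δu, -∂_ν u - βφ)`. -/
def WentzellRel (β : LinfΓ Ω) (x y : HSum Ω) : Prop :=
  ∃ (u : H1 Ω) (h : L2Γ Ω),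
    x.fst = H1.toL2 u ∧ IsApproxTrace Ω u x.snd ∧
    HasWeakLaplacian Ω (H1.toL2 u) y.fst ∧ IsNormalDeriv Ω u y.fst h ∧
    y.snd = -h - (β • x.snd : L2Γ Ω)

/-- Multiplication by `β ∈ L^∞(Γ)` on `L²(Γ)`. -/
def mulΓ (β : LinfΓ Ω) : L2Γ Ω →ₗ[ℂ] L2Γ Ω where
  toFun φ := β • φ
  map_add' φ ψ := Lp.add_smul β φ ψ
  map_smul' c φ := (Lp.smul_comm c β φ).symm

/-- The form `a(u, v) = ∫_Ω ∇u · ∇v̄ + ∫_Γ β u v̄` on `C(Ω̄) ∩ H¹(Ω)`. -/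
def wentzellForm (β : LinfΓ Ω) : ContH1 Ω →ₗ[ℂ] ContH1 Ω →ₛₗ[starRingEnd ℂ] ℂ :=
  innerForm (ContH1.grad (Ω := Ω)) (ContH1.grad (Ω := Ω)) +
    innerForm ((mulΓ Ω β).comp (ContH1.onΓ (Ω := Ω))) (ContH1.onΓ (Ω := Ω))

lemma wentzellForm_apply (β : LinfΓ Ω) (u v : ContH1 Ω) :
    wentzellForm Ω β u v =
      ⟪H1.grad (ContH1.toH1 v), H1.grad (ContH1.toH1 u)⟫_ℂ +
        ⟪ContH1.onΓ v, (β • ContH1.onΓ u : L2Γ Ω)⟫_ℂ :=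
  rfl

/-- The map `j(u) = (u, u|_Γ)` from `C(Ω̄) ∩ H¹(Ω)` to `L²(Ω) ⊕ L²(Γ)`. -/
def wentzellJ : ContH1 Ω →ₗ[ℂ] HSum Ω where
  toFun u := WithLp.toLp 2 (H1.toL2 (ContH1.toH1 u), ContH1.onΓ u)
  map_add' _ _ := rfl
  map_smul' _ _ := rfl

end Operator

end Wentzell

end

noncomputable section

namespace Wentzell

/-! ### Exponentials of accretive bounded operators -/

section Exponential

variable {H : Type*} [NormedAddCommGroup H] [InnerProductSpace ℂ H] [CompleteSpace H]

/-! With `D` the gradient and `B` the bounded operator `(f, φ) ↦ (0, β φ)`, the form is `(D u | D v)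
+ (B j u | j v)`. Its first part is nonnegative on the diagonal, so adding `2 * ‖B‖ * ‖j u‖ ^ 2`
puts the numerical range into the sector of half-angle `π/4`.

The form domain is completed inside `H ⊕ G` as the closure `formSpace` of the pairs `(j u, D u)`.
Here this closure consists of the `((u, φ), ∇u)` with `φ ∈ Tr(u)` (`mem_formSpace_wentzell_iff`). It
is the graph of an operator, because `j` retains `u` itself and the weak gradient of `0` is `0`. The
identity defining the associated operator is then Green's formula with `h = -y.snd - β φ`, and
testing it inside `Ω` yields the distributional Laplacian (`wentzellRel_iff_mem_formGraph`).

For generation, Lax–Milgram on `formSpace` gives the range condition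
(`exists_formGraph_smul_add_eq`), so a shift of the operator is m-sectorial. Its Yosida
approximations `Y n` commute and keep the numerical range in the same sector. Hence the `exp (-(z •
Y n))` are contractions for `|arg z| ≤ π/4` and converge strongly, locally uniformly in `z`, to a
holomorphic contraction semigroup. Undoing the shift multiplies it by `exp (ω z)`. -/

lemma hasDerivAt_exp_real_smul_apply (Y : H →L[ℂ] H) (x : H) (t : ℝ) :
    HasDerivAt (fun s : ℝ => NormedSpace.exp (s • Y) x) (Y (NormedSpace.exp (t • Y) x)) t := by
  have h := hasDerivAt_exp_smul_const' (𝕂 := ℝ) Y t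
  exact ((ContinuousLinearMap.apply ℂ H x).restrictScalars ℝ).hasFDerivAt.comp_hasDerivAt t h

lemma hasDerivAt_exp_real_smul_apply' (Y : H →L[ℂ] H) (x : H) (t : ℝ) :
    HasDerivAt (fun s : ℝ => NormedSpace.exp (s • Y) x) (NormedSpace.exp (t • Y) (Y x)) t := by
  have h := hasDerivAt_exp_smul_const (𝕂 := ℝ) Y t
  exact ((ContinuousLinearMap.apply ℂ H x).restrictScalars ℝ).hasFDerivAt.comp_hasDerivAt t h

/-- The derivative of `s ↦ ‖exp (-sY) x‖ ^ 2` is `-2 Re ⟪z, Y z⟫` at `z = exp (-sY) x`, so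
accretivity makes this function nonincreasing. -/
lemma norm_exp_neg_apply_le {Y : H →L[ℂ] H} (hY : ∀ x, 0 ≤ (⟪x, Y x⟫_ℂ).re) (x : H) :
    ‖NormedSpace.exp (-Y) x‖ ≤ ‖x‖ := by
  let _ : InnerProductSpace ℝ H := InnerProductSpace.rclikeToReal ℂ H
  have hd : ∀ t : ℝ, HasDerivAt (fun s : ℝ => ‖NormedSpace.exp (s • (-Y)) x‖ ^ 2)
      (2 * inner ℝ (NormedSpace.exp (t • (-Y)) x) ((-Y) (NormedSpace.exp (t • (-Y)) x))) t :=
    fun t => (hasDerivAt_exp_real_smul_apply (-Y) x t).norm_sq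
  have ha : Antitone fun s : ℝ => ‖NormedSpace.exp (s • (-Y)) x‖ ^ 2 := by
    refine antitone_of_deriv_nonpos (fun t => (hd t).differentiableAt) fun t => ?_
    rw [(hd t).deriv, real_inner_eq_re_inner ℂ]
    have := hY (NormedSpace.exp (t • (-Y)) x)
    simp only [neg_apply, inner_neg_right, map_neg, RCLike.re_eq_complex_re]
    linarith
  have h := ha zero_le_one
  simp only [one_smul, zero_smul, NormedSpace.exp_zero, one_apply_eq_self] at h
  exact (sq_le_sq₀ (norm_nonneg _) (norm_nonneg _)).1 h

/-- Interpolate along `exp (-(s Y + (1 - s) Y')) x`. Since `Y` and `Y'` commute, the derivative in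
`s` is the same exponential applied to `(Y' - Y) x`. Convex combinations of accretive operators are
accretive, so that exponential is a contraction and the mean value inequality applies. -/
lemma norm_exp_neg_apply_sub_le {Y Y' : H →L[ℂ] H} (hc : Commute Y Y')
    (hY : ∀ x, 0 ≤ (⟪x, Y x⟫_ℂ).re) (hY' : ∀ x, 0 ≤ (⟪x, Y' x⟫_ℂ).re) (x : H) :
    ‖NormedSpace.exp (-Y) x - NormedSpace.exp (-Y') x‖ ≤ ‖Y x - Y' x‖ := by
  let _ : NormedAlgebra ℚ (H →L[ℂ] H) := NormedAlgebra.restrictScalars ℚ ℝ (H →L[ℂ] H)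
  have hcom : ∀ s : ℝ, Commute (-Y') (s • (Y' - Y)) := fun s =>
    (((Commute.refl Y').sub_right hc.symm).neg_left).smul_right s
  have key : ∀ s : ℝ, NormedSpace.exp (-Y') * NormedSpace.exp (s • (Y' - Y))
      = NormedSpace.exp (-(s • Y + (1 - s) • Y')) := fun s => by
    rw [← NormedSpace.exp_add_of_commute (hcom s)]
    congr 1
    module
  have hd : ∀ s : ℝ, HasDerivAt
      (fun s : ℝ => NormedSpace.exp (-Y') (NormedSpace.exp (s • (Y' - Y)) x))
      (NormedSpace.exp (-Y') (NormedSpace.exp (s • (Y' - Y)) ((Y' - Y) x))) s := fun s =>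
    ((NormedSpace.exp (-Y')).restrictScalars ℝ).hasFDerivAt.comp_hasDerivAt s
      (hasDerivAt_exp_real_smul_apply' (Y' - Y) x s)
  have hb := norm_image_sub_le_of_norm_deriv_le_segment_01' (C := ‖Y x - Y' x‖)
    (fun s _ => (hd s).hasDerivWithinAt) (fun s hs => ?_)
  · have e1 := congrArg (fun T : H →L[ℂ] H => T x) (key 1)
    have e0 := congrArg (fun T : H →L[ℂ] H => T x) (key 0)
    simp only [mul_apply_eq_comp] at e1 e0
    rw [e1, e0] at hb
    simpa using hb
  · have e := congrArg (fun T : H →L[ℂ] H => T ((Y' - Y) x)) (key s)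
    simp only [mul_apply_eq_comp] at e
    rw [e]
    refine (norm_exp_neg_apply_le (fun z => ?_) _).trans ?_
    · have h1 : (⟪z, (s • Y + (1 - s) • Y') z⟫_ℂ).re
          = s * (⟪z, Y z⟫_ℂ).re + (1 - s) * (⟪z, Y' z⟫_ℂ).re := by
        simp [inner_smul_right_eq_smul]
      rw [h1]
      have := hY z
      have := hY' z
      have := hs.1
      have := hs.2
      have : 0 ≤ 1 - s := by linarith
      positivity
    · rw [sub_apply, norm_sub_rev]

lemma norm_exp_neg_apply_sub_self_le {Y : H →L[ℂ] H} (hY : ∀ x, 0 ≤ (⟪x, Y x⟫_ℂ).re) (x : H) :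
    ‖NormedSpace.exp (-Y) x - x‖ ≤ ‖Y x‖ := by
  simpa using norm_exp_neg_apply_sub_le (Commute.zero_right Y) hY (by simp) x

end Exponential

/-! ### Strong holomorphy implies holomorphy in norm -/

section Holomorphy

variable {E F : Type*} [NormedAddCommGroup E] [NormedSpace ℂ E] [NormedAddCommGroup F]
  [NormedSpace ℂ F]

/-- The Schwarz lemma on a ball of radius `r` bounds `‖T z x - T c x‖` by `(2 C ‖x‖ / r) |z - c|`.
This is linear in `‖x‖`, hence an operator-norm estimate. -/
lemma continuousOn_of_differentiableOn_apply {U : Set ℂ} (hU : IsOpen U) {T : ℂ → E →L[ℂ] F} {C : ℝ}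
    (hT : ∀ z ∈ U, ‖T z‖ ≤ C) (hd : ∀ x, DifferentiableOn ℂ (fun z => T z x) U) :
    ContinuousOn T U := by
  intro c hc
  obtain ⟨r, hr, hrU⟩ := Metric.isOpen_iff.1 hU c hc
  have hC : 0 ≤ C := (norm_nonneg _).trans (hT c hc)
  have hlip : ∀ z ∈ Metric.ball c r, ‖T z - T c‖ ≤ (2 * C / r) * dist z c := by
    intro z hz
    refine ContinuousLinearMap.opNorm_le_bound _ (by positivity) fun x => ?_
    have hm : Set.MapsTo (fun w => T w x) (Metric.ball c r)
        (Metric.closedBall (T c x) (2 * C * ‖x‖)) := by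
      intro w hw
      rw [Metric.mem_closedBall, dist_eq_norm]
      have h1 := (T w).le_of_opNorm_le (hT w (hrU hw)) x
      have h2 := (T c).le_of_opNorm_le (hT c hc) x
      exact (norm_sub_le _ _).trans (by linarith)
    have h := Complex.dist_le_div_mul_dist_of_mapsTo_ball ((hd x).mono hrU) hm hz
    rw [dist_eq_norm] at h
    calc ‖(T z - T c) x‖ = ‖T z x - T c x‖ := rfl
      _ ≤ _ := h
      _ = _ := by ring
  refine ContinuousAt.continuousWithinAt ?_
  rw [ContinuousAt, tendsto_iff_norm_sub_tendsto_zero]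
  have hl : Tendsto (fun z => (2 * C / r) * dist z c) (𝓝 c) (𝓝 0) := by
    have : Continuous fun z : ℂ => (2 * C / r) * dist z c := by fun_prop
    simpa using this.tendsto c
  refine squeeze_zero' (Eventually.of_forall fun _ => norm_nonneg _) ?_ hl
  filter_upwards [Metric.ball_mem_nhds c hr] with z hz using hlip z hz

/-- Norm continuity makes the operator-valued Cauchy integral meaningful, and that integral is
analytic. It equals `T`, since Cauchy's formula holds after applying both sides to any vector. -/
lemma differentiableOn_of_differentiableOn_apply [CompleteSpace F] {U : Set ℂ} (hU : IsOpen U) {T : ℂ → E →L[ℂ] F}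
    {C : ℝ} (hT : ∀ z ∈ U, ‖T z‖ ≤ C) (hd : ∀ x, DifferentiableOn ℂ (fun z => T z x) U) :
    DifferentiableOn ℂ T U := by
  have hcont := continuousOn_of_differentiableOn_apply hU hT hd
  intro c hc
  obtain ⟨r, hr, hrU⟩ := Metric.nhds_basis_closedBall.mem_iff.1 (hU.mem_nhds hc)
  lift r to ℝ≥0 using hr.le
  have hci : CircleIntegrable T c r :=
    (hcont.mono (Metric.sphere_subset_closedBall.trans hrU)).circleIntegrable r.2
  have hps := hasFPowerSeriesOn_cauchy_integral hci (by exact_mod_cast hr)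
  have heq : ∀ w ∈ Metric.ball c (r : ℝ),
      (2 * (Real.pi : ℂ) * Complex.I)⁻¹ • (∮ z in C(c, r), (z - w)⁻¹ • T z) = T w := by
    intro w hw
    ext x
    have h1 := ((hd x).mono hrU).circleIntegral_sub_inv_smul hw
    have h2 : (∮ z in C(c, r), (z - w)⁻¹ • T z) x = ∮ z in C(c, r), (z - w)⁻¹ • T z x := by
      have hci' : CircleIntegrable (fun z => (z - w)⁻¹ • T z) c r := by
        have hT' := hcont.mono (Metric.sphere_subset_closedBall.trans hrU)
        have hinv : ContinuousOn (fun z => (z - w)⁻¹) (Metric.sphere c (r : ℝ)) := by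
          refine ContinuousOn.inv₀ (by fun_prop) fun z hz => ?_
          rw [sub_ne_zero]
          rintro rfl
          rw [Metric.mem_sphere] at hz
          rw [Metric.mem_ball] at hw
          exact hw.ne hz
        exact (hinv.smul hT').circleIntegrable r.2
      have := (ContinuousLinearMap.apply ℂ F x).intervalIntegral_comp_comm hci'.out
      simp only [circleIntegral]
      rw [ContinuousLinearMap.apply_apply] at this
      rw [← this]
      rfl
    have h3 : (2 * (Real.pi : ℂ) * Complex.I) ≠ 0 := Complex.two_pi_I_ne_zero
    rw [smul_apply, h2, h1, smul_smul, inv_mul_cancel₀ h3, one_smul]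
  have hev : T =ᶠ[𝓝 c]
      fun w => (2 * (Real.pi : ℂ) * Complex.I)⁻¹ • ∮ z in C(c, r), (z - w)⁻¹ • T z := by
    filter_upwards [Metric.ball_mem_nhds c hr] with w hw using (heq w hw).symm
  exact (hps.analyticAt.differentiableAt.congr_of_eventuallyEq hev).differentiableWithinAt

end Holomorphy

/-! ### Resolvents and Yosida approximations of m-sectorial operators -/

section Yosida

variable {H : Type*} [NormedAddCommGroup H] [InnerProductSpace ℂ H]

/-- The submodule `P` of `H × H` is the graph of an m-sectorial operator with vertex `0` and
semi-angle `π/4`. -/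
structure IsMSectorialGraph (P : Submodule ℂ (H × H)) : Prop where
  eq_zero : ∀ y, ((0 : H), y) ∈ P → y = 0
  sector : ∀ x y, (x, y) ∈ P → |(⟪x, y⟫_ℂ).im| ≤ (⟪x, y⟫_ℂ).re
  surj : ∀ l : ℝ, 0 < l → ∀ f, ∃ x y, (x, y) ∈ P ∧ (l : ℂ) • x + y = f

namespace IsMSectorialGraph

variable {P : Submodule ℂ (H × H)}

lemma re_nonneg (hP : IsMSectorialGraph P) {x y : H} (h : (x, y) ∈ P) : 0 ≤ (⟪x, y⟫_ℂ).re :=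
  (abs_nonneg _).trans (hP.sector x y h)

/-- Pair `l x + y` with `x`: accretivity bounds the real part below by `l ‖x‖ ^ 2`, Cauchy–Schwarz
bounds it above. -/
lemma mul_norm_le (hP : IsMSectorialGraph P) {l : ℝ} {x y : H} (h : (x, y) ∈ P) :
    l * ‖x‖ ≤ ‖(l : ℂ) • x + y‖ := by
  rcases eq_or_ne x 0 with rfl | hx
  · simp
  have h1 : (⟪x, (l : ℂ) • x + y⟫_ℂ).re = l * ‖x‖ ^ 2 + (⟪x, y⟫_ℂ).re := by
    rw [inner_add_right, inner_smul_right, inner_self_eq_norm_sq_to_K]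
    simp [← Complex.ofReal_pow]
  have h2 : (⟪x, (l : ℂ) • x + y⟫_ℂ).re ≤ ‖x‖ * ‖(l : ℂ) • x + y‖ :=
    (Complex.re_le_norm _).trans (norm_inner_le_norm _ _)
  have h3 := hP.re_nonneg h
  have h4 : 0 < ‖x‖ := norm_pos_iff.2 hx
  refine le_of_mul_le_mul_left ?_ h4
  nlinarith

lemma eq_of_smul_add_eq (hP : IsMSectorialGraph P) {l : ℝ} (hl : 0 < l) {x y x' y' : H}
    (h : (x, y) ∈ P) (h' : (x', y') ∈ P) (e : (l : ℂ) • x + y = (l : ℂ) • x' + y') : x = x' := by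
  have h1 := hP.mul_norm_le (l := l) (P.sub_mem h h')
  have h2 : (l : ℂ) • (x - x') + (y - y') = 0 := by
    rw [smul_sub, sub_add_sub_comm, e, sub_self]
  have h3 : l * ‖x - x'‖ ≤ 0 := by rwa [h2, norm_zero] at h1
  have h4 : ‖x - x'‖ ≤ 0 := by
    by_contra! hc
    nlinarith
  exact sub_eq_zero.1 (norm_le_zero_iff.1 h4)

lemma exists_resolvent (hP : IsMSectorialGraph P) {l : ℝ} (hl : 0 < l) :
    ∃ J : H →L[ℂ] H, (∀ f, (J f, f - (l : ℂ) • J f) ∈ P) ∧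
      (∀ x y, (x, y) ∈ P → J ((l : ℂ) • x + y) = x) ∧ ∀ f, l * ‖J f‖ ≤ ‖f‖ := by
  choose J K hJ hK using hP.surj l hl
  have hK' : ∀ f, K f = f - (l : ℂ) • J f := fun f => eq_sub_of_add_eq' (hK f)
  have hu : ∀ x y, (x, y) ∈ P → J ((l : ℂ) • x + y) = x := fun x y h =>
    hP.eq_of_smul_add_eq hl (hJ _) h (hK _)
  have hb : ∀ f, l * ‖J f‖ ≤ ‖f‖ := fun f => by
    have := hP.mul_norm_le (l := l) (hJ f)
    rwa [hK f] at this
  -- The chosen solution map is linear because solutions are unique and `P` is a subspace.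
  let L : H →ₗ[ℂ] H :=
    { toFun := J
      map_add' := fun f g => by
        have := hu _ _ (P.add_mem (hJ f) (hJ g))
        rw [← this, smul_add, add_add_add_comm, hK, hK]
      map_smul' := fun c f => by
        have := hu _ _ (P.smul_mem c (hJ f))
        simp only [RingHom.id_apply]
        rw [← this, smul_comm, ← smul_add, hK] }
  refine ⟨L.mkContinuous l⁻¹ fun f => ?_, fun f => ?_, hu, hb⟩
  · rw [inv_mul_eq_div, le_div_iff₀ hl, mul_comm]
    exact hb f
  · have := hJ f
    rwa [hK'] at this

/-- Let `f` be orthogonal to the domain and solve `u + v = f` with `(u, v) ∈ P`. Then `0 = Re ⟪u, f⟫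
≥ ‖u‖ ^ 2`, so `u = 0`, and single-valuedness gives `f = v = 0`. -/
lemma dense_domain [CompleteSpace H] (hP : IsMSectorialGraph P) (x : H) {ε : ℝ} (hε : 0 < ε) :
    ∃ z w, (z, w) ∈ P ∧ ‖x - z‖ < ε := by
  let D : Submodule ℂ H := P.map (LinearMap.fst ℂ H H)
  have hD : D.topologicalClosure = ⊤ := by
    rw [Submodule.topologicalClosure_eq_top_iff, Submodule.eq_bot_iff]
    intro f hf
    obtain ⟨u, v, huv, e⟩ := hP.surj 1 one_pos f
    have h1 : ⟪u, f⟫_ℂ = 0 := (Submodule.mem_orthogonal D f).1 hf u ⟨(u, v), huv, rfl⟩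
    have h2 := hP.mul_norm_le (l := 1) huv
    rw [← e, Complex.ofReal_one, one_smul, inner_add_right, inner_self_eq_norm_sq_to_K] at h1
    have h3 := congrArg Complex.re h1
    have h4 := hP.re_nonneg huv
    simp only [Complex.coe_algebraMap, ← Complex.ofReal_pow, Complex.add_re, Complex.ofReal_re,
      Complex.zero_re] at h3
    have hu : u = 0 := by
      have : ‖u‖ ^ 2 = 0 := le_antisymm (by linarith) (sq_nonneg _)
      simpa using this
    subst hu
    rw [← e, hP.eq_zero v huv]
    simp
  have hx : x ∈ closure (D : Set H) := by
    rw [← Submodule.topologicalClosure_coe, hD]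
    trivial
  obtain ⟨z, ⟨⟨z', w⟩, hzw, rfl⟩, hz⟩ := Metric.mem_closure_iff.1 hx ε hε
  exact ⟨z', w, hzw, by rwa [dist_eq_norm] at hz⟩

/-- With `A` the operator of `P` and `J n = (n + 1 + A)⁻¹`, the approximation is `Y n = (n + 1) (1 -
(n + 1) J n)`, which is `(n + 1) J n A` on the domain. The parameter is `n + 1` so that it is
positive also for `n = 0`. -/
lemma exists_yosida [CompleteSpace H] (hP : IsMSectorialGraph P) :
    ∃ Y : ℕ → H →L[ℂ] H, (∀ m n, Commute (Y m) (Y n)) ∧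
      (∀ n x, |(⟪x, Y n x⟫_ℂ).im| ≤ (⟪x, Y n x⟫_ℂ).re) ∧
      (∀ x y, (x, y) ∈ P → ∀ n, ‖Y n x‖ ≤ ‖y‖) ∧
      ∀ x y, (x, y) ∈ P → Tendsto (fun n => Y n x) atTop (𝓝 y) := by
  have hpos : ∀ n : ℕ, 0 < (n + 1 : ℝ) := fun n => by positivity
  choose J hJ hu hb using fun n : ℕ => hP.exists_resolvent (hpos n)
  have hcomm : ∀ m n, Commute (J m) (J n) := by
    -- The resolvent identity; exchanging `m` and `n` in it gives commutation.
    have hres : ∀ m n f, J m f - J n f = ((n : ℂ) - m) • J m (J n f) := fun m n f => by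
      have h := hu m _ _ (hJ n f)
      rw [map_add, map_sub, map_smul, map_smul] at h
      calc J m f - J n f = J m f - (((m + 1 : ℝ) : ℂ) • J m (J n f)
            + (J m f - ((n + 1 : ℝ) : ℂ) • J m (J n f))) := by rw [h]
        _ = _ := by push_cast; module
    intro m n
    rcases eq_or_ne m n with rfl | hmn
    · exact Commute.refl _
    ext f
    have h1 := hres m n f
    have h2 := hres n m f
    have h3 : ((n : ℂ) - m) ≠ 0 := sub_ne_zero.2 (by exact_mod_cast hmn.symm)
    refine smul_right_injective H h3 ?_
    simp only [mul_apply_eq_comp]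
    rw [← h1, ← neg_sub, h2, ← neg_smul, neg_sub]
  let Y : ℕ → H →L[ℂ] H := fun n =>
    ((n + 1 : ℝ) : ℂ) • (ContinuousLinearMap.id ℂ H - ((n + 1 : ℝ) : ℂ) • J n)
  have hYJ : ∀ n x y, (x, y) ∈ P → Y n x = ((n + 1 : ℝ) : ℂ) • J n y := fun n x y h => by
    have := hu n x y h
    simp only [map_add, map_smul] at this
    change ((n + 1 : ℝ) : ℂ) • (x - ((n + 1 : ℝ) : ℂ) • J n x) = _
    rw [sub_eq_of_eq_add' this.symm]
  have hbound : ∀ (n : ℕ) y, ‖((n + 1 : ℝ) : ℂ) • J n y‖ ≤ ‖y‖ := fun n y => by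
    rw [norm_smul, Complex.norm_real, Real.norm_of_nonneg (hpos n).le]
    exact hb n y
  refine ⟨Y, fun m n => ?_, fun n x => ?_, fun x y h n => ?_, fun x y h => ?_⟩
  · exact (((Commute.one_left _).sub_left (((Commute.one_right _).sub_right
      ((hcomm m n).smul_right _)).smul_left _)).smul_left _).smul_right _
  -- Here `Y n x = A v` and `x = v + (n + 1)⁻¹ Y n x`, so `⟪x, Y n x⟫` is `⟪v, A v⟫` plus a
  -- nonnegative real number and stays in the sector.
  · set v := ((n + 1 : ℝ) : ℂ) • J n x with hv
    have hmem : (v, Y n x) ∈ P := P.smul_mem ((n + 1 : ℝ) : ℂ) (hJ n x)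
    have hx : x = v + (((n + 1 : ℝ)⁻¹ : ℝ) : ℂ) • Y n x := by
      change x = v + (((n + 1 : ℝ)⁻¹ : ℝ) : ℂ) • ((n + 1 : ℝ) : ℂ) • (x - v)
      rw [smul_smul, ← Complex.ofReal_mul, inv_mul_cancel₀ (hpos n).ne']
      simp
    have hin : ⟪x, Y n x⟫_ℂ = ⟪v, Y n x⟫_ℂ + (((n + 1 : ℝ)⁻¹ * ‖Y n x‖ ^ 2 : ℝ) : ℂ) := by
      nth_rewrite 1 [hx]
      rw [inner_add_left, add_right_inj, inner_smul_left, inner_self_eq_norm_sq_to_K, Complex.conj_ofReal]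
      simp
    have := hP.sector _ _ hmem
    rw [hin, Complex.add_im, Complex.add_re, Complex.ofReal_im, Complex.ofReal_re, add_zero]
    have : 0 ≤ (n + 1 : ℝ)⁻¹ * ‖Y n x‖ ^ 2 := by positivity
    linarith
  · rw [hYJ n x y h]
    exact hbound n y
  · rw [Metric.tendsto_atTop]
    intro ε hε
    obtain ⟨z, w, hzw, hz⟩ := hP.dense_domain y (ε := ε / 3) (by positivity)
    obtain ⟨N, hN⟩ := exists_nat_gt (‖w‖ / (ε / 3))
    refine ⟨N, fun n hn => ?_⟩
    -- On the domain `(n + 1) J n z` tends to `z`, since `‖J n w‖ ≤ ‖w‖ / (n + 1)`. Density and the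
    -- contractivity of `(n + 1) J n` extend this to `y`.
    have e1 : ((n + 1 : ℝ) : ℂ) • J n z = z - J n w := by
      have := hu n z w hzw
      rw [map_add, map_smul] at this
      exact eq_sub_of_add_eq this
    have e2 : ‖J n w‖ < ε / 3 := by
      have h1 := hb n w
      have h2 : (N : ℝ) ≤ n := by exact_mod_cast hn
      rw [div_lt_iff₀ (by positivity)] at hN
      have h3 : ‖w‖ < (n + 1) * (ε / 3) := hN.trans_le (by nlinarith)
      exact lt_of_mul_lt_mul_left (h1.trans_lt h3) (hpos n).le
    have e3 := hbound n (y - z)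
    rw [dist_eq_norm, hYJ n x y h]
    have e4 : ((n + 1 : ℝ) : ℂ) • J n y - y
        = ((n + 1 : ℝ) : ℂ) • J n (y - z) - J n w - (y - z) := by
      rw [map_sub, smul_sub, e1]
      abel
    rw [e4]
    calc _ ≤ ‖((n + 1 : ℝ) : ℂ) • J n (y - z)‖ + ‖J n w‖ + ‖y - z‖ :=
          (norm_sub_le _ _).trans (by gcongr; exact norm_sub_le _ _)
      _ < ε := by linarith

end IsMSectorialGraph

end Yosida

/-! ### The semigroup generated by an m-sectorial operator -/

section Generation

variable {H : Type*} [NormedAddCommGroup H] [InnerProductSpace ℂ H]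

/-- Two numbers of argument at most `π/4` in modulus have a product in the right half-plane. This is
what turns the sector condition into holomorphy of the semigroup. -/
lemma re_inner_smul_apply_nonneg {Y : H →L[ℂ] H}
    (hY : ∀ x, |(⟪x, Y x⟫_ℂ).im| ≤ (⟪x, Y x⟫_ℂ).re) {z : ℂ} (hz : |z.im| ≤ z.re) (x : H) :
    0 ≤ (⟪x, (z • Y) x⟫_ℂ).re := by
  rw [smul_apply, inner_smul_right, Complex.mul_re]
  have h1 : |z.im * (⟪x, Y x⟫_ℂ).im| ≤ z.re * (⟪x, Y x⟫_ℂ).re := by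
    rw [abs_mul]
    exact mul_le_mul hz (hY x) (abs_nonneg _) ((abs_nonneg _).trans hz)
  linarith [le_abs_self (z.im * (⟪x, Y x⟫_ℂ).im)]

lemma isOpen_abs_im_lt_re : IsOpen {z : ℂ | |z.im| < z.re} :=
  isOpen_lt (by fun_prop) (by fun_prop)

lemma openSector_pi_div_four_subset : openSector (Real.pi / 4) ⊆ {z : ℂ | |z.im| < z.re} := by
  rintro z ⟨hz, ha⟩
  have hpi := Real.pi_pos
  have hn : 0 < ‖z‖ := norm_pos_iff.2 hz
  have h1 : |Real.sin z.arg| < Real.cos z.arg := by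
    rw [Real.abs_sin_eq_sin_abs_of_abs_le_pi (by linarith), ← Real.cos_abs]
    have h2 : Real.sin |z.arg| < Real.sin (Real.pi / 4) :=
      Real.sin_lt_sin_of_lt_of_le_pi_div_two (by linarith [abs_nonneg z.arg]) (by linarith) ha
    have h3 : Real.cos (Real.pi / 4) < Real.cos |z.arg| :=
      Real.cos_lt_cos_of_nonneg_of_le_pi (abs_nonneg _) (by linarith) ha
    rw [Real.sin_pi_div_four] at h2
    rw [Real.cos_pi_div_four] at h3
    linarith
  rw [Set.mem_ofPred_eq, ← Complex.norm_mul_sin_arg, ← Complex.norm_mul_cos_arg, abs_mul,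
    abs_of_pos hn]
  exact mul_lt_mul_of_pos_left h1 hn

variable [CompleteSpace H] {P : Submodule ℂ (H × H)}

/-- An m-sectorial operator is the negative of the generator of a contraction semigroup that is
holomorphic on the sector of half-angle `π/4`. -/
theorem IsMSectorialGraph.exists_contraction_semigroup (hP : IsMSectorialGraph P) :
    ∃ S : ℂ → H →L[ℂ] H, S 0 = ContinuousLinearMap.id ℂ H ∧
      (∀ z w, |z.im| ≤ z.re → |w.im| ≤ w.re → S (z + w) = (S z).comp (S w)) ∧
      (∀ z, |z.im| ≤ z.re → ‖S z‖ ≤ 1) ∧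
      (∀ z, |z.im| ≤ z.re → ∀ x y, (x, y) ∈ P → ‖S z x - x‖ ≤ ‖z‖ * ‖y‖) ∧
      DifferentiableOn ℂ S {z | |z.im| < z.re} ∧
      ∀ x y, (x, y) ∈ P → ∀ ε > 0, ∃ δ > 0, ∀ t : ℝ, 0 ≤ t → t ≤ δ →
        ‖S (t : ℂ) x - x + t • y‖ ≤ ε * t := by
  obtain ⟨Y, hcomm, hsec, hbd, hlim⟩ := hP.exists_yosida
  set E : ℕ → ℂ → H →L[ℂ] H := fun n z => NormedSpace.exp (-(z • Y n)) with hE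
  have hacc : ∀ n (z : ℂ), |z.im| ≤ z.re → ∀ x, 0 ≤ (⟪x, (z • Y n) x⟫_ℂ).re := fun n z hz x =>
    re_inner_smul_apply_nonneg (hsec n) hz x
  have hE1 : ∀ n z, |z.im| ≤ z.re → ∀ x, ‖E n z x‖ ≤ ‖x‖ := fun n z hz x =>
    norm_exp_neg_apply_le (hacc n z hz) x
  have hEE : ∀ m n z, |z.im| ≤ z.re → ∀ x, ‖E m z x - E n z x‖ ≤ ‖z‖ * ‖Y m x - Y n x‖ :=
    fun m n z hz x => by
      have := norm_exp_neg_apply_sub_le (((hcomm m n).smul_left z).smul_right z) (hacc m z hz)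
        (hacc n z hz) x
      rwa [smul_apply, smul_apply, ← smul_sub, norm_smul] at this
  have hE0 : ∀ n z, |z.im| ≤ z.re → ∀ x y, (x, y) ∈ P → ‖E n z x - x‖ ≤ ‖z‖ * ‖y‖ :=
    fun n z hz x y hxy => by
      have := norm_exp_neg_apply_sub_self_le (hacc n z hz) x
      rw [smul_apply, norm_smul] at this
      exact this.trans (by gcongr; exact hbd x y hxy n)
  -- The sequence is Cauchy uniformly for `‖z‖ ≤ R`: approximate `x` from the domain, where `hEE`
  -- applies, and absorb the error by contractivity. The uniformity in `z` makes the limit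
  -- holomorphic.
  have hU : ∀ x (R : ℝ), ∀ ε > 0, ∃ N, ∀ m ≥ N, ∀ n ≥ N, ∀ z : ℂ, |z.im| ≤ z.re → ‖z‖ ≤ R →
      ‖E m z x - E n z x‖ < ε := by
    intro x R ε hε
    obtain ⟨x', y', hxy, hx⟩ := hP.dense_domain x (ε := ε / 4) (by positivity)
    obtain ⟨N, hN⟩ := Metric.cauchySeq_iff.1 (hlim x' y' hxy).cauchySeq (ε / (4 * (|R| + 1)))
      (by positivity)
    refine ⟨N, fun m hm n hn z hz hzR => ?_⟩
    have h1 := hE1 m z hz (x - x')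
    have h2 := hE1 n z hz (x - x')
    have h3 := hEE m n z hz x'
    have h4 := hN m hm n hn
    rw [dist_eq_norm, lt_div_iff₀ (by positivity)] at h4
    have h5 : ‖z‖ * ‖Y m x' - Y n x'‖ ≤ (|R| + 1) * ‖Y m x' - Y n x'‖ := by
      gcongr
      exact hzR.trans ((le_abs_self R).trans (by linarith))
    have h6 : E m z x - E n z x = E m z (x - x') - E n z (x - x') + (E m z x' - E n z x') := by
      rw [map_sub, map_sub]
      abel
    rw [h6]
    calc _ ≤ ‖E m z (x - x')‖ + ‖E n z (x - x')‖ + ‖E m z x' - E n z x'‖ :=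
          (norm_add_le _ _).trans (by gcongr; exact norm_sub_le _ _)
      _ < ε := by linarith
  -- Outside the closed sector nothing is required of `T`, and the value `0` serves.
  have hS : ∀ z : ℂ, ∃ T : H →L[ℂ] H, |z.im| ≤ z.re →
      ∀ x, Tendsto (fun n => E n z x) atTop (𝓝 (T x)) := by
    intro z
    by_cases hz : |z.im| ≤ z.re
    · have hc : ∀ x, ∃ l, Tendsto (fun n => E n z x) atTop (𝓝 l) := fun x => by
        refine cauchySeq_tendsto_of_complete (Metric.cauchySeq_iff.2 fun ε hε => ?_)
        obtain ⟨N, hN⟩ := hU x ‖z‖ ε hε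
        exact ⟨N, fun m hm n hn => by
          rw [dist_eq_norm]
          exact hN m hm n hn z hz le_rfl⟩
      choose f hf using hc
      exact ⟨continuousLinearMapOfTendsto (fun n => E n z) (tendsto_pi_nhds.2 hf), fun _ => hf⟩
    · exact ⟨0, fun h => absurd h hz⟩
  choose S hSl using hS
  have hS1 : ∀ z, |z.im| ≤ z.re → ∀ x, ‖S z x‖ ≤ ‖x‖ := fun z hz x =>
    le_of_tendsto (hSl z hz x).norm (Eventually.of_forall fun n => hE1 n z hz x)
  have hS1' : ∀ z, |z.im| ≤ z.re → ‖S z‖ ≤ 1 := fun z hz =>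
    ContinuousLinearMap.opNorm_le_bound _ zero_le_one fun x => by simpa using hS1 z hz x
  refine ⟨S, ?_, fun z w hz hw => ?_, hS1', fun z hz x y hxy => ?_, ?_, fun x y hxy ε hε => ?_⟩
  · ext x
    refine tendsto_nhds_unique (hSl 0 (by simp) x) ?_
    simp [hE]
  · have hzw : |(z + w).im| ≤ (z + w).re := by
      rw [Complex.add_im, Complex.add_re]
      exact (abs_add_le _ _).trans (add_le_add hz hw)
    ext x
    refine tendsto_nhds_unique (hSl _ hzw x) ?_
    -- Both the operator and its argument vary with `n`; contractivity of `E n z` disposes of the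
    -- first summand.
    have hmul : ∀ n, E n (z + w) x = E n z (E n w x - S w x) + E n z (S w x) := fun n => by
      let _ : NormedAlgebra ℚ (H →L[ℂ] H) := NormedAlgebra.restrictScalars ℚ ℝ (H →L[ℂ] H)
      have hc : Commute (-(z • Y n)) (-(w • Y n)) :=
        (((Commute.refl (Y n)).smul_left z).smul_right w).neg_left.neg_right
      rw [map_sub, sub_add_cancel]
      simp only [hE]
      rw [add_smul, neg_add, NormedSpace.exp_add_of_commute hc]
      rfl
    simp only [hmul]
    rw [ContinuousLinearMap.comp_apply, ← zero_add (S z (S w x))]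
    refine Tendsto.add ?_ (hSl z hz _)
    refine squeeze_zero_norm (fun n => hE1 n z hz _) ?_
    exact tendsto_iff_norm_sub_tendsto_zero.1 (hSl w hw x)
  · exact le_of_tendsto ((hSl z hz x).sub_const x).norm
      (Eventually.of_forall fun n => hE0 n z hz x y hxy)
  · refine differentiableOn_of_differentiableOn_apply isOpen_abs_im_lt_re
      (fun z hz => hS1' z (le_of_lt hz)) fun x => ?_
    refine TendstoLocallyUniformlyOn.differentiableOn (F := fun n z => E n z x) (φ := atTop) ?_
      (Eventually.of_forall fun n z _ => ?_) isOpen_abs_im_lt_re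
    · rw [Metric.tendstoLocallyUniformlyOn_iff]
      intro ε hε z hz
      obtain ⟨N, hN⟩ := hU x (‖z‖ + 1) (ε / 2) (by positivity)
      refine ⟨_, inter_mem_nhdsWithin _ (Metric.ball_mem_nhds z one_pos),
        eventually_atTop.2 ⟨N, fun n hn w hw => ?_⟩⟩
      have hw1 : |w.im| ≤ w.re := le_of_lt hw.1
      have hw2 : ‖w‖ ≤ ‖z‖ + 1 := by
        have h1 : ‖w - z‖ < 1 := by simpa [dist_eq_norm] using hw.2
        have h2 := norm_add_le z (w - z)
        rw [add_sub_cancel] at h2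
        linarith
      have h := le_of_tendsto ((hSl w hw1 x).sub_const (E n w x)).norm
        (eventually_atTop.2 ⟨N, fun m hm => (hN m hm n hn w hw1 hw2).le⟩)
      rw [dist_eq_norm]
      linarith
    · have hd := hasDerivAt_exp_smul_const (𝕂 := ℂ) (-(Y n)) z
      have hd' := (ContinuousLinearMap.apply ℂ H x).hasFDerivAt.comp_hasDerivAt z hd
      simp only [hE]
      simp only [smul_neg] at hd'
      exact hd'.differentiableAt.differentiableWithinAt
  · obtain ⟨z, w, hzw, hz⟩ := hP.dense_domain y (ε := ε / 4) (by positivity)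
    obtain ⟨N, hN⟩ := Metric.tendsto_atTop.1 (hlim x y hxy) (ε / 4) (by positivity)
    -- The derivative of `exp (-s Y n) x + s y` is split below into four terms of norm at most `ε /
    -- 4`. This `δ` handles `E n s z - z`, of norm at most `s ‖w‖`.
    refine ⟨ε / (4 * (‖w‖ + 1)), by positivity, fun t ht htδ => ?_⟩
    have hK : ∀ s : ℝ, 0 ≤ s → |(s : ℂ).im| ≤ (s : ℂ).re := fun s hs => by simpa using hs
    refine le_of_tendsto (((hSl (t : ℂ) (hK t ht) x).sub_const x).add_const (t • y)).norm
      (eventually_atTop.2 ⟨N, fun n hn => ?_⟩)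
    have hreal : ∀ s : ℝ, E n (s : ℂ) = NormedSpace.exp (s • (-(Y n))) := fun s => by
      simp only [hE, Complex.coe_smul, smul_neg]
    have hd : ∀ s : ℝ, HasDerivAt (fun s : ℝ => NormedSpace.exp (s • (-(Y n))) x + s • y)
        (NormedSpace.exp (s • (-(Y n))) ((-(Y n)) x) + y) s := fun s => by
      have h1 := (hasDerivAt_exp_real_smul_apply' (-(Y n)) x s).add
        ((hasDerivAt_id s).smul_const y)
      rw [one_smul] at h1
      exact h1
    have hm := norm_image_sub_le_of_norm_deriv_le_segment' (C := ε)
      (fun s _ => (hd s).hasDerivWithinAt) (fun s hs => ?_) t ⟨ht, le_rfl⟩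
    · have h0 : NormedSpace.exp ((0 : ℝ) • (-(Y n))) x = x := by simp
      rw [h0, zero_smul, add_zero, sub_zero, ← hreal] at hm
      rwa [sub_add_eq_add_sub]
    · rw [← hreal]
      have hs' := hK s hs.1
      have h1 := hE1 n s hs' (Y n x - y)
      have h2 := hE1 n s hs' (y - z)
      have h3 := hE0 n s hs' z w hzw
      have h4 := hN n hn
      rw [dist_eq_norm] at h4
      have h5 : s * ‖w‖ ≤ ε / 4 := by
        have h6 : s ≤ ε / (4 * (‖w‖ + 1)) := hs.2.le.trans htδ
        rw [le_div_iff₀ (by positivity)] at h6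
        nlinarith [hs.1]
      rw [Complex.norm_real, Real.norm_of_nonneg hs.1] at h3
      have h6 : E n s ((-(Y n)) x) + y
          = -(E n s (Y n x - y)) - E n s (y - z) - (E n s z - z) + (y - z) := by
        rw [neg_apply, map_neg, map_sub, map_sub]
        abel
      rw [h6]
      calc _ ≤ ‖E n s (Y n x - y)‖ + ‖E n s (y - z)‖ + ‖E n s z - z‖ + ‖y - z‖ := by
            refine (norm_add_le _ _).trans ?_
            gcongr
            refine (norm_sub_le _ _).trans ?_
            gcongr
            refine (norm_sub_le _ _).trans ?_
            rw [norm_neg]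
        _ ≤ ε := by linarith

/-- A quasi-m-sectorial operator generates a holomorphic `C₀`-semigroup. -/
theorem IsMSectorialGraph.exists_isGenerator (hP : IsMSectorialGraph P) (A : H →ₗ.[ℂ] H) (ω : ℝ)
    (hA : ∀ x y, (x, y) ∈ A.graph ↔ (x, (ω : ℂ) • x - y) ∈ P) :
    ∃ S : ℝ≥0 → H →L[ℂ] H, IsHolomorphicC0Semigroup S ∧ IsGenerator A S := by
  obtain ⟨S, hS0, hSadd, hS1, hSdom, hSd, hSgen⟩ := hP.exists_contraction_semigroup
  have hK : ∀ t : ℝ≥0, |((t : ℝ) : ℂ).im| ≤ ((t : ℝ) : ℂ).re := fun t => by simp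
  have hS1x : ∀ (t : ℝ≥0) x, ‖S (t : ℝ) x‖ ≤ ‖x‖ := fun t x => by
    simpa using (S (t : ℝ)).le_of_opNorm_le (hS1 _ (hK t)) x
  have hexp : Continuous fun t : ℝ≥0 => Complex.exp ((ω : ℂ) * ((t : ℝ) : ℂ)) := by fun_prop
  have hScont : ∀ x, Tendsto (fun t : ℝ≥0 => S (t : ℝ) x) (𝓝 0) (𝓝 x) := by
    intro x
    rw [Metric.tendsto_nhds]
    intro ε hε
    obtain ⟨z, w, hzw, hz⟩ := hP.dense_domain x (ε := ε / 4) (by positivity)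
    have hsm : ∀ᶠ t : ℝ≥0 in 𝓝 0, (t : ℝ) * ‖w‖ < ε / 4 := by
      have hc : Continuous fun t : ℝ≥0 => (t : ℝ) * ‖w‖ := by fun_prop
      exact hc.tendsto 0 (Iio_mem_nhds (by simpa using hε))
    filter_upwards [hsm] with t ht
    have h1 := hS1x t (x - z)
    have h2 := hSdom _ (hK t) z w hzw
    rw [Complex.norm_real, Real.norm_of_nonneg t.coe_nonneg] at h2
    have h3 : S (t : ℝ) x - x = S (t : ℝ) (x - z) + (S (t : ℝ) z - z) - (x - z) := by
      rw [map_sub]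
      abel
    rw [dist_eq_norm, h3]
    calc _ ≤ ‖S (t : ℝ) (x - z)‖ + ‖S (t : ℝ) z - z‖ + ‖x - z‖ :=
          (norm_sub_le _ _).trans (by gcongr; exact norm_add_le _ _)
      _ < ε := by linarith
  have hgen1 : ∀ x y, (x, y) ∈ P →
      Tendsto (fun t : ℝ≥0 => ((t : ℝ) : ℂ)⁻¹ • (S (t : ℝ) x - x)) (𝓝[>] 0) (𝓝 (-y)) := by
    intro x y hxy
    rw [Metric.tendsto_nhds]
    intro ε hε
    obtain ⟨δ, hδ, h⟩ := hSgen x y hxy (ε / 2) (by positivity)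
    have hsm : ∀ᶠ t : ℝ≥0 in 𝓝[>] 0, (t : ℝ) < δ := by
      have hc : Continuous fun t : ℝ≥0 => (t : ℝ) := by fun_prop
      exact (hc.tendsto 0).mono_left nhdsWithin_le_nhds (Iio_mem_nhds (by simpa using hδ))
    filter_upwards [hsm, self_mem_nhdsWithin] with t ht ht0
    have ht0' : (0 : ℝ) < t := ht0
    have h1 := h t t.2 ht.le
    have h0 : ((t : ℝ) : ℂ) ≠ 0 := by exact_mod_cast ht0'.ne'
    have h2 : ((t : ℝ) : ℂ)⁻¹ • (S (t : ℝ) x - x) - -y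
        = ((t : ℝ) : ℂ)⁻¹ • (S (t : ℝ) x - x + (t : ℝ) • y) := by
      rw [smul_add, ← Complex.coe_smul, inv_smul_smul₀ h0, sub_neg_eq_add]
    rw [dist_eq_norm, h2, norm_smul, norm_inv, Complex.norm_real, Real.norm_of_nonneg t.coe_nonneg,
      inv_mul_lt_iff₀ ht0']
    nlinarith
  have hgen : ∀ x y, (x, -y) ∈ P ↔
      Tendsto (fun t : ℝ≥0 => ((t : ℝ) : ℂ)⁻¹ • (S (t : ℝ) x - x)) (𝓝[>] 0) (𝓝 y) := by
    intro x y
    refine ⟨fun h => by simpa using hgen1 x (-y) h, fun h => ?_⟩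
    -- The generator has no proper extension of this kind: with this choice it would map `x - x'` to
    -- itself, whereas the generator of a contraction semigroup is dissipative. Hence `x = x'`.
    obtain ⟨x', y', hxy', e⟩ := hP.surj 1 one_pos (x - y)
    rw [Complex.ofReal_one, one_smul] at e
    have hw : Tendsto (fun t : ℝ≥0 => ((t : ℝ) : ℂ)⁻¹ • (S (t : ℝ) (x - x') - (x - x')))
        (𝓝[>] 0) (𝓝 (x - x')) := by
      have h1 := h.sub (hgen1 x' y' hxy')
      have h2 : y - -y' = x - x' := by
        rw [sub_neg_eq_add, eq_sub_iff_add_eq, add_assoc, add_comm y' x', e]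
        abel
      rw [h2] at h1
      refine h1.congr fun t => ?_
      rw [← smul_sub, map_sub]
      congr 1
      abel
    have hre : (⟪x - x', x - x'⟫_ℂ).re ≤ 0 := by
      have hc : Continuous fun v : H => (⟪x - x', v⟫_ℂ).re :=
        Complex.continuous_re.comp (continuous_const.inner continuous_id)
      refine le_of_tendsto ((hc.tendsto _).comp hw) (Eventually.of_forall fun t => ?_)
      simp only [Function.comp_apply]
      rw [← Complex.ofReal_inv, inner_smul_right, Complex.re_ofReal_mul, inner_sub_right,
        Complex.sub_re]
      refine mul_nonpos_of_nonneg_of_nonpos (inv_nonneg.2 t.2) ?_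
      have h1 : (⟪x - x', S (t : ℝ) (x - x')⟫_ℂ).re ≤ ‖x - x'‖ * ‖S (t : ℝ) (x - x')‖ :=
        (Complex.re_le_norm _).trans (norm_inner_le_norm _ _)
      have h2 := hS1x t (x - x')
      have h3 : (⟪x - x', x - x'⟫_ℂ).re = ‖x - x'‖ * ‖x - x'‖ :=
        inner_self_eq_norm_mul_norm (𝕜 := ℂ) _
      nlinarith [norm_nonneg (x - x')]
    have hx : x = x' := sub_eq_zero.1 ((re_inner_self_nonpos (𝕜 := ℂ)).1 hre)
    subst hx
    have hy : -y = y' := by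
      rw [sub_eq_add_neg] at e
      exact (add_left_cancel e).symm
    rwa [hy]
  -- `P` is the graph of `ω - A`, so `A` is the generator of the contraction semigroup plus `ω`.
  refine ⟨fun t => Complex.exp ((ω : ℂ) * ((t : ℝ) : ℂ)) • S (t : ℝ), ⟨⟨?_, fun s t => ?_, fun x => ?_⟩,
    Real.pi / 4, by positivity, by linarith [Real.pi_pos],
    fun z => Complex.exp ((ω : ℂ) * z) • S z, ?_, fun t _ => rfl, fun θ' _ hθ' => ?_⟩,
    fun x y => ?_⟩
  · simp [hS0]
  · ext x
    have := hSadd _ _ (hK s) (hK t)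
    simp only [NNReal.coe_add, Complex.ofReal_add, this, mul_add, Complex.exp_add, smul_apply,
      ContinuousLinearMap.comp_apply, map_smul, smul_smul]
    rw [mul_comm]
  · simpa using (hexp.tendsto 0).smul (hScont x)
  · have h1 : DifferentiableOn ℂ (fun z => Complex.exp ((ω : ℂ) * z)) (openSector (Real.pi / 4)) := by
      fun_prop
    exact h1.smul (hSd.mono openSector_pi_div_four_subset)
  · refine ⟨Real.exp |ω|, fun z hz hz1 => ?_⟩
    have hz' := openSector_pi_div_four_subset ⟨hz.1, hz.2.trans hθ'⟩
    rw [norm_smul, Complex.norm_exp, Complex.re_ofReal_mul]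
    have h1 : ω * z.re ≤ |ω| := by
      have h2 : |z.re| ≤ 1 := (Complex.abs_re_le_norm z).trans hz1
      calc ω * z.re ≤ |ω * z.re| := le_abs_self _
        _ = |ω| * |z.re| := abs_mul _ _
        _ ≤ |ω| * 1 := by gcongr
        _ = |ω| := mul_one _
    calc _ ≤ Real.exp |ω| * 1 :=
          mul_le_mul (Real.exp_le_exp.2 h1) (hS1 z (le_of_lt hz')) (norm_nonneg _) (Real.exp_nonneg _)
      _ = _ := mul_one _
  · rw [hA, ← neg_sub, hgen]
    have hder : Tendsto (fun t : ℝ≥0 => ((t : ℝ) : ℂ)⁻¹ • (Complex.exp ((ω : ℂ) * ((t : ℝ) : ℂ)) - 1))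
        (𝓝[>] 0) (𝓝 (ω : ℂ)) := by
      have h1 : HasDerivAt (fun t : ℝ => Complex.exp ((ω : ℂ) * (t : ℂ))) (ω : ℂ) 0 := by
        simpa using ((Complex.ofRealCLM.hasDerivAt (x := 0)).const_mul (ω : ℂ)).cexp
      have h2 := h1.tendsto_slope_zero
      have h3 : Tendsto (fun t : ℝ≥0 => (t : ℝ)) (𝓝[>] 0) (𝓝[≠] 0) := by
        refine tendsto_nhdsWithin_iff.2 ⟨?_, ?_⟩
        · exact (NNReal.continuous_coe.tendsto 0).mono_left nhdsWithin_le_nhds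
        · filter_upwards [self_mem_nhdsWithin] with t ht
          have : (0 : ℝ) < t := ht
          exact this.ne'
      refine (h2.comp h3).congr fun t => ?_
      simp
    have hexp0 : Tendsto (fun t : ℝ≥0 => Complex.exp ((ω : ℂ) * ((t : ℝ) : ℂ))) (𝓝[>] 0) (𝓝 1) := by
      simpa using (hexp.tendsto 0).mono_left (nhdsWithin_le_nhds (s := Set.Ioi 0))
    constructor
    · intro h
      have h1 := (hexp0.smul h).add (hder.smul_const x)
      rw [one_smul, sub_add_cancel] at h1
      refine h1.congr fun t => ?_
      simp only [smul_apply]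
      module
    · intro h
      have h1 := ((hexp0.inv₀ one_ne_zero).smul (h.sub (hder.smul_const x)))
      rw [inv_one, one_smul] at h1
      refine h1.congr fun t => ?_
      rw [inv_smul_eq_iff₀ (Complex.exp_ne_zero _)]
      simp only [smul_apply]
      module

end Generation

/-! ### Operators associated with sectorial forms -/

section AssociatedOperator

lemma mem_closedSector_pi_div_four {z : ℂ} (hz : |z.im| ≤ z.re) :
    z ∈ closedSector (Real.pi / 4) := by
  refine ⟨‖z‖, z.arg, norm_nonneg _, ?_, (Complex.norm_mul_exp_arg_mul_I z).symm⟩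
  by_contra! h
  have hpi := Real.pi_pos
  have h0 : 0 ≤ z.re := (abs_nonneg _).trans hz
  have h1 : |z.arg| ≤ Real.pi / 2 := Complex.abs_arg_le_pi_div_two_iff.2 h0
  have hn : 0 < ‖z‖ := norm_pos_iff.2 fun h2 => by
    rw [h2, Complex.arg_zero, abs_zero] at h
    linarith
  rw [← Complex.norm_mul_sin_arg, ← Complex.norm_mul_cos_arg, abs_mul, abs_of_pos hn,
    mul_le_mul_iff_right₀ hn, Real.abs_sin_eq_sin_abs_of_abs_le_pi (by linarith),
    ← Real.cos_abs] at hz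
  have h2 : Real.sin (Real.pi / 4) < Real.sin |z.arg| :=
    Real.sin_lt_sin_of_lt_of_le_pi_div_two (by linarith) h1 h
  have h3 : Real.cos |z.arg| < Real.cos (Real.pi / 4) :=
    Real.cos_lt_cos_of_nonneg_of_le_pi (by linarith) (by linarith) h
  rw [Real.sin_pi_div_four] at h2
  rw [Real.cos_pi_div_four] at h3
  linarith

variable {W H G : Type*} [AddCommGroup W] [Module ℂ W]
  [NormedAddCommGroup H] [InnerProductSpace ℂ H] [NormedAddCommGroup G] [InnerProductSpace ℂ G]

lemma inner_self_eq_ofReal_norm_sq (x : H) : ⟪x, x⟫_ℂ = ((‖x‖ ^ 2 : ℝ) : ℂ) := by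
  rw [inner_self_eq_norm_sq_to_K]
  simp

lemma norm_inner_apply_self_le (B : H →L[ℂ] H) (x : H) : ‖⟪x, B x⟫_ℂ‖ ≤ ‖B‖ * ‖x‖ ^ 2 := by
  calc _ ≤ ‖x‖ * ‖B x‖ := norm_inner_le_norm _ _
    _ ≤ ‖x‖ * (‖B‖ * ‖x‖) := by gcongr; exact B.le_opNorm x
    _ = _ := by ring

/-- Only `B` contributes to the imaginary part, by at most `‖B‖ ‖x‖ ^ 2`. One copy of `‖B‖ ‖x‖ ^ 2`
in the shift compensates its real part and the other dominates its imaginary part. -/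
lemma abs_im_le_re_of_bounded_perturbation (B : H →L[ℂ] H) (x : H) (g : G) :
    |(⟪g, g⟫_ℂ + ⟪x, B x⟫_ℂ + ((2 * ‖B‖ * ‖x‖ ^ 2 : ℝ) : ℂ)).im| ≤
      (⟪g, g⟫_ℂ + ⟪x, B x⟫_ℂ + ((2 * ‖B‖ * ‖x‖ ^ 2 : ℝ) : ℂ)).re := by
  have h0 := norm_inner_apply_self_le B x
  have h1 := (Complex.abs_im_le_norm ⟪x, B x⟫_ℂ).trans h0
  have h2 := neg_le_of_abs_le ((Complex.abs_re_le_norm ⟪x, B x⟫_ℂ).trans h0)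
  rw [inner_self_eq_ofReal_norm_sq g]
  simp only [Complex.add_im, Complex.add_re, Complex.ofReal_im, Complex.ofReal_re, zero_add, add_zero]
  nlinarith [sq_nonneg ‖g‖]

lemma tendsto_sub_atTop_nhds_zero {K : Type*} [NormedAddCommGroup K] {f : ℕ → K} {l : K}
    (h : Tendsto f atTop (𝓝 l)) : Tendsto (fun p : ℕ × ℕ => f p.1 - f p.2) atTop (𝓝 0) := by
  rw [← prod_atTop_atTop_eq, ← sub_self l]
  exact (h.comp tendsto_fst).sub (h.comp tendsto_snd)

/-- The map `w ↦ (j w, D w)`. -/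
def formJet (j : W →ₗ[ℂ] H) (D : W →ₗ[ℂ] G) : W →ₗ[ℂ] WithLp 2 (H × G) :=
  (WithLp.linearEquiv 2 ℂ (H × G)).symm.toLinearMap.comp (j.prod D)

/-- The completion of the domain of a form `(D u | D v) + (B j u | j v)`, realised in `H ⊕ G`. -/
def formSpace (j : W →ₗ[ℂ] H) (D : W →ₗ[ℂ] G) : Submodule ℂ (WithLp 2 (H × G)) :=
  (LinearMap.range (formJet j D)).topologicalClosure

lemma mem_formSpace_iff_seq {j : W →ₗ[ℂ] H} {D : W →ₗ[ℂ] G} {p : WithLp 2 (H × G)} :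
    p ∈ formSpace j D ↔ ∃ u : ℕ → W, Tendsto (fun n => j (u n)) atTop (𝓝 p.fst) ∧
      Tendsto (fun n => D (u n)) atTop (𝓝 p.snd) := by
  have hcont : Continuous fun q : WithLp 2 (H × G) => (q.fst, q.snd) :=
    WithLp.prod_continuous_ofLp 2 H G
  have hcont' : Continuous fun q : H × G => WithLp.toLp 2 q := WithLp.prod_continuous_toLp 2 H G
  rw [formSpace, ← SetLike.mem_coe, Submodule.topologicalClosure_coe, mem_closure_iff_seq_limit]
  constructor
  · rintro ⟨s, hs, hlim⟩
    choose u hu using hs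
    have h := (hcont.tendsto p).comp hlim
    refine ⟨u, ?_, ?_⟩
    · refine ((continuous_fst.tendsto _).comp h).congr fun n => ?_
      simp only [Function.comp_apply, ← hu n]
      rfl
    · refine ((continuous_snd.tendsto _).comp h).congr fun n => ?_
      simp only [Function.comp_apply, ← hu n]
      rfl
  · rintro ⟨u, h1, h2⟩
    exact ⟨fun n => formJet j D (u n), fun n => ⟨u n, rfl⟩,
      (hcont'.tendsto (p.fst, p.snd)).comp (h1.prodMk_nhds h2)⟩

lemma formJet_mem_formSpace (j : W →ₗ[ℂ] H) (D : W →ₗ[ℂ] G) (w : W) :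
    formJet j D w ∈ formSpace j D :=
  Submodule.le_topologicalClosure _ ⟨w, rfl⟩

/-- The graph of the operator associated with the closure of `(D u | D v) + (B j u | j v)`. -/
def formGraph (j : W →ₗ[ℂ] H) (D : W →ₗ[ℂ] G) (B : H →L[ℂ] H) : Submodule ℂ (H × H) where
  carrier := {p | ∃ g : G, WithLp.toLp 2 (p.1, g) ∈ formSpace j D ∧
    ∀ w, ⟪D w, g⟫_ℂ + ⟪j w, B p.1⟫_ℂ = ⟪j w, p.2⟫_ℂ}
  add_mem' := by
    rintro p q ⟨g, hg, h⟩ ⟨g', hg', h'⟩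
    refine ⟨g + g', (formSpace j D).add_mem hg hg', fun w => ?_⟩
    simp only [Prod.fst_add, Prod.snd_add, map_add, inner_add_right, ← h, ← h']
    ring
  zero_mem' := ⟨0, (formSpace j D).zero_mem, by simp⟩
  smul_mem' := by
    rintro c p ⟨g, hg, h⟩
    refine ⟨c • g, (formSpace j D).smul_mem c hg, fun w => ?_⟩
    simp only [Prod.smul_fst, Prod.smul_snd, map_smul, inner_smul_right, ← h]
    ring

lemma mem_formGraph {j : W →ₗ[ℂ] H} {D : W →ₗ[ℂ] G} {B : H →L[ℂ] H} {x y : H} :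
    (x, y) ∈ formGraph j D B ↔ ∃ g : G, WithLp.toLp 2 (x, g) ∈ formSpace j D ∧
      ∀ w, ⟪D w, g⟫_ℂ + ⟪j w, B x⟫_ℂ = ⟪j w, y⟫_ℂ :=
  Iff.rfl

/-- Both sides are continuous in the test element, so the closure may be used for testing. In
particular the solution `(x, g)` can be tested against itself. -/
lemma inner_eq_of_mem_formSpace {j : W →ₗ[ℂ] H} {D : W →ₗ[ℂ] G} {g : G} {x y : H}
    (h : ∀ w, ⟪D w, g⟫_ℂ + ⟪j w, x⟫_ℂ = ⟪j w, y⟫_ℂ) {q : WithLp 2 (H × G)}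
    (hq : q ∈ formSpace j D) : ⟪q.snd, g⟫_ℂ + ⟪q.fst, x⟫_ℂ = ⟪q.fst, y⟫_ℂ := by
  obtain ⟨u, h1, h2⟩ := mem_formSpace_iff_seq.1 hq
  refine tendsto_nhds_unique (((h2.inner tendsto_const_nhds).add
    (h1.inner tendsto_const_nhds)).congr fun n => h (u n)) (h1.inner tendsto_const_nhds)

variable {j : W →ₗ[ℂ] H} {D : W →ₗ[ℂ] G} {B : H →L[ℂ] H}
  {a : W →ₗ[ℂ] W →ₛₗ[starRingEnd ℂ] ℂ}

lemma isSectorialForm_of_bounded_perturbation (hj : DenseRange j)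
    (ha : ∀ u v, a u v = ⟪D v, D u⟫_ℂ + ⟪j v, B (j u)⟫_ℂ) : IsSectorialForm a j :=
  ⟨hj, 2 * ‖B‖, Real.pi / 4, by positivity, by linarith [Real.pi_pos], fun u =>
    mem_closedSector_pi_div_four (by
      rw [ha]
      exact abs_im_le_re_of_bounded_perturbation B (j u) (D u))⟩

/-- Once `j (u n)` converges, the `B`-part of `a (u n - u m) (u n - u m)` vanishes in the limit. The
condition on `a` then says exactly that `D (u n)` is Cauchy. -/
lemma formOperatorRel_iff_mem_formGraph [CompleteSpace G]
    (ha : ∀ u v, a u v = ⟪D v, D u⟫_ℂ + ⟪j v, B (j u)⟫_ℂ) (x y : H) :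
    FormOperatorRel a j x y ↔ (x, y) ∈ formGraph j D B := by
  have hlim : ∀ {u : ℕ → W} {g : G}, Tendsto (fun n => j (u n)) atTop (𝓝 x) →
      Tendsto (fun n => D (u n)) atTop (𝓝 g) → ∀ v,
      Tendsto (fun n => a (u n) v) atTop (𝓝 (⟪D v, g⟫_ℂ + ⟪j v, B x⟫_ℂ)) := by
    intro u g h1 h2 v
    simp only [ha]
    exact (tendsto_const_nhds.inner h2).add
      (tendsto_const_nhds.inner ((B.continuous.tendsto x).comp h1))
  have hB : ∀ {u : ℕ → W}, Tendsto (fun n => j (u n)) atTop (𝓝 x) →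
      Tendsto (fun p : ℕ × ℕ => ⟪j (u p.1 - u p.2), B (j (u p.1 - u p.2))⟫_ℂ) atTop (𝓝 0) := by
    intro u h
    have h1 := tendsto_sub_atTop_nhds_zero h
    have h2 := h1.inner ((B.continuous.tendsto 0).comp h1) (𝕜 := ℂ)
    rw [map_zero, inner_zero_left] at h2
    refine h2.congr fun p => ?_
    simp only [Function.comp_apply, map_sub]
  rw [mem_formGraph]
  constructor
  · rintro ⟨u, h1, h2, h3⟩
    have h4 : Tendsto (fun p : ℕ × ℕ => ‖D (u p.1) - D (u p.2)‖ ^ 2) atTop (𝓝 0) := by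
      have h5 := (h2.sub (hB h1)).norm
      rw [sub_zero, norm_zero] at h5
      refine h5.congr fun p => ?_
      rw [ha, add_sub_cancel_right, ← map_sub, inner_self_eq_norm_sq_to_K]
      simp
    have h5 : CauchySeq fun n => D (u n) := by
      rw [cauchySeq_iff_tendsto_dist_atTop_0]
      have h6 := h4.sqrt
      simpa [dist_eq_norm] using h6
    obtain ⟨g, hg⟩ := cauchySeq_tendsto_of_complete h5
    exact ⟨g, mem_formSpace_iff_seq.2 ⟨u, h1, hg⟩, fun w =>
      tendsto_nhds_unique (hlim h1 hg w) (h3 w)⟩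
  · rintro ⟨g, hg, h⟩
    obtain ⟨u, h1, h2⟩ := mem_formSpace_iff_seq.1 hg
    refine ⟨u, h1, ?_, fun v => ?_⟩
    · have h3 := tendsto_sub_atTop_nhds_zero h2
      have h4 := (h3.inner h3 (𝕜 := ℂ)).add (hB h1)
      simp only [inner_zero_left, add_zero] at h4
      refine h4.congr fun p => ?_
      rw [ha, map_sub D]
    · rw [← h v]
      exact hlim h1 h2 v

variable [CompleteSpace H] [CompleteSpace G]

lemma exists_formGraph_smul_add_eq (j : W →ₗ[ℂ] H) (D : W →ₗ[ℂ] G) (B : H →L[ℂ] H) {l : ℝ}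
    (hl : 2 * ‖B‖ < l) (f : H) : ∃ x, (x, f - (l : ℂ) • x) ∈ formGraph j D B := by
  have hB0 : 0 ≤ ‖B‖ := norm_nonneg B
  set V := formSpace j D with hV
  have : CompleteSpace V := (Submodule.isClosed_topologicalClosure _).completeSpace_coe
  let T : WithLp 2 (H × G) →L[ℂ] WithLp 2 (H × G) :=
    ((WithLp.prodContinuousLinearEquiv 2 ℂ H G).symm : (H × G) →L[ℂ] WithLp 2 (H × G)).comp
      (((B + (l : ℂ) • ContinuousLinearMap.id ℂ H).prodMap (ContinuousLinearMap.id ℂ G)).comp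
        (WithLp.prodContinuousLinearEquiv 2 ℂ H G : WithLp 2 (H × G) →L[ℂ] H × G))
  have hT : ∀ p q, ⟪q, T p⟫_ℂ = ⟪q.fst, B p.fst + (l : ℂ) • p.fst⟫_ℂ + ⟪q.snd, p.snd⟫_ℂ :=
    fun p q => WithLp.prod_inner_apply _ _
  -- Lax–Milgram: `C` represents on `V` the form with the terms `B + l` on `H` and the identity on
  -- `G`. It is coercive with constant `min 1 (l - ‖B‖)`.
  let C : V →L[ℂ] V := V.orthogonalProjectionOnto.comp (T.comp V.subtypeL)
  have hC : ∀ p q : V, ⟪q, C p⟫_ℂ = ⟪(q : WithLp 2 (H × G)), T p⟫_ℂ := fun p q =>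
    V.inner_orthogonalProjectionOnto_eq_of_mem_left _ _
  set c : ℝ := min 1 (l - ‖B‖) with hc
  have hc0 : 0 < c := lt_min one_pos (by linarith)
  have hunit : IsUnit C := by
    refine C.isUnit_of_forall_le_norm_inner_map (c := ⟨c, hc0.le⟩) hc0 fun p => ?_
    rw [norm_inner_symm, hC, hT]
    refine le_trans ?_ (Complex.re_le_norm _)
    have h2 : ‖p‖ ^ 2 = ‖(p : WithLp 2 (H × G)).fst‖ ^ 2 + ‖(p : WithLp 2 (H × G)).snd‖ ^ 2 :=
      WithLp.prod_norm_sq_eq_of_L2 _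
    have h4 := norm_inner_apply_self_le B (p : WithLp 2 (H × G)).fst
    have h5 := neg_le_of_abs_le ((Complex.abs_re_le_norm _).trans h4)
    rw [inner_add_right, inner_smul_right, inner_self_eq_ofReal_norm_sq,
      inner_self_eq_ofReal_norm_sq]
    simp only [Complex.add_re, Complex.re_ofReal_mul, Complex.ofReal_re]
    rw [h2]
    change _ * c ≤ _
    have h6 : c ≤ 1 := min_le_left _ _
    have h7 : c ≤ l - ‖B‖ := min_le_right _ _
    nlinarith [sq_nonneg ‖(p : WithLp 2 (H × G)).fst‖, sq_nonneg ‖(p : WithLp 2 (H × G)).snd‖]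
  -- The projection of `(f, 0)` represents the functional `q ↦ ⟪q.fst, f⟫` on `V`.
  obtain ⟨p, hp⟩ := (C.isUnit_iff_bijective.1 hunit).2
    (V.orthogonalProjectionOnto (WithLp.toLp 2 (f, 0)))
  refine ⟨(p : WithLp 2 (H × G)).fst, (p : WithLp 2 (H × G)).snd, p.2, fun w => ?_⟩
  have h1 := hC p ⟨formJet j D w, formJet_mem_formSpace j D w⟩
  rw [hp, V.inner_orthogonalProjectionOnto_eq_of_mem_left, hT] at h1
  have h2 : ⟪formJet j D w, WithLp.toLp 2 (f, (0 : G))⟫_ℂ = ⟪j w, f⟫_ℂ := by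
    rw [WithLp.prod_inner_apply]
    simp [formJet]
  have h3 : (⟪j w, f⟫_ℂ : ℂ) = ⟪j w, B (p : WithLp 2 (H × G)).fst
      + (l : ℂ) • (p : WithLp 2 (H × G)).fst⟫_ℂ + ⟪D w, (p : WithLp 2 (H × G)).snd⟫_ℂ := h2.symm.trans h1
  rw [inner_sub_right, h3, inner_add_right]
  ring

/-- The operator associated with a densely defined closable form `(D u | D v) + (B j u | j v)` is
the negative of the generator of a holomorphic `C₀`-semigroup. -/
theorem exists_generator_of_form (B : H →L[ℂ] H) (hj : DenseRange j)
    (hcl : ∀ g : G, WithLp.toLp 2 ((0 : H), g) ∈ formSpace j D → g = 0) :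
    ∃ A : H →ₗ.[ℂ] H, (∀ x y, (x, y) ∈ A.graph ↔ (x, -y) ∈ formGraph j D B) ∧
      ∃ S : ℝ≥0 → H →L[ℂ] H, IsHolomorphicC0Semigroup S ∧ IsGenerator A S := by
  -- Closability removes `g`; then `y` is orthogonal to the dense range of `j`.
  have hzero : ∀ y, ((0 : H), y) ∈ formGraph j D B → y = 0 := by
    rintro y ⟨g, hg, h⟩
    obtain rfl := hcl g hg
    refine hj.eq_zero_of_inner_right ℂ ?_
    intro w
    simpa using (h w).symm
  let Q : Submodule ℂ (H × H) := (formGraph j D B).comap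
    (LinearMap.prodMap LinearMap.id (-LinearMap.id))
  have hQ : ∀ x y, (x, y) ∈ Q ↔ (x, -y) ∈ formGraph j D B := fun _ _ => Iff.rfl
  -- The associated operator plus `2 * ‖B‖`, the shift that brings its numerical range into the
  -- sector.
  let P : Submodule ℂ (H × H) := (formGraph j D B).comap
    ((LinearMap.fst ℂ H H).prod (LinearMap.snd ℂ H H - ((2 * ‖B‖ : ℝ) : ℂ) • LinearMap.fst ℂ H H))
  have hPmem : ∀ x y, (x, y) ∈ P ↔ (x, y - ((2 * ‖B‖ : ℝ) : ℂ) • x) ∈ formGraph j D B :=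
    fun _ _ => Iff.rfl
  have hP : IsMSectorialGraph P := by
    refine ⟨fun y hy => ?_, fun x y hxy => ?_, fun l hl f => ?_⟩
    · rw [hPmem, smul_zero, sub_zero] at hy
      exact hzero y hy
    · obtain ⟨g, hg, h⟩ := (hPmem x y).1 hxy
      have h1 : ⟪g, g⟫_ℂ + ⟪x, B x⟫_ℂ = ⟪x, y - ((2 * ‖B‖ : ℝ) : ℂ) • x⟫_ℂ :=
        inner_eq_of_mem_formSpace h hg
      have h2 : ⟪x, y⟫_ℂ = ⟪g, g⟫_ℂ + ⟪x, B x⟫_ℂ + ((2 * ‖B‖ * ‖x‖ ^ 2 : ℝ) : ℂ) := by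
        rw [h1, inner_sub_right, inner_smul_right, inner_self_eq_norm_sq_to_K]
        simp
      rw [h2]
      exact abs_im_le_re_of_bounded_perturbation B x g
    · obtain ⟨x, hx⟩ := exists_formGraph_smul_add_eq j D B
        (l := 2 * ‖B‖ + l) (by linarith) f
      refine ⟨x, f - (l : ℂ) • x, ?_, by abel⟩
      rw [hPmem]
      convert hx using 2
      push_cast
      module
  have hQ0 : ∀ p ∈ Q, p.1 = 0 → p.2 = 0 := by
    rintro ⟨x, y⟩ hp rfl
    exact neg_eq_zero.1 (hzero _ hp)
  refine ⟨Q.toLinearPMap, fun x y => ?_, hP.exists_isGenerator _ (2 * ‖B‖) fun x y => ?_⟩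
  · rw [Q.toLinearPMap_graph_eq hQ0, hQ]
  · rw [Q.toLinearPMap_graph_eq hQ0, hQ, hPmem, sub_sub_cancel_left]

end AssociatedOperator

/-! ### Smooth functions in `C(Ω̄) ∩ H¹(Ω)` -/

section Smooth

variable {d : ℕ}

lemma memLp_two_of_contDiff {μ : Measure (EuclideanSpace ℝ (Fin d))} [IsFiniteMeasureOnCompacts μ]
    {f : EuclideanSpace ℝ (Fin d) → ℂ} (hf : ContDiff ℝ (⊤ : ℕ∞) f) (hc : HasCompactSupport f) :
    MemLp f 2 μ :=
  hf.continuous.memLp_of_hasCompactSupport hc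

lemma contDiff_fderiv_apply_const {f : EuclideanSpace ℝ (Fin d) → ℂ} (hf : ContDiff ℝ (⊤ : ℕ∞) f)
    (v : EuclideanSpace ℝ (Fin d)) : ContDiff ℝ (⊤ : ℕ∞) fun x => fderiv ℝ f x v :=
  (hf.fderiv_right (m := ((⊤ : ℕ∞) : WithTop ℕ∞)) (by simp)).clm_apply contDiff_const

lemma inner_toLp_left {α : Type*} [MeasurableSpace α] {μ : Measure α} {f : α → ℂ}
    (hf : MemLp f 2 μ) (u : Lp ℂ 2 μ) : ⟪hf.toLp f, u⟫_ℂ = ∫ x, u x * conj (f x) ∂μ := by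
  rw [L2.inner_def]
  refine integral_congr_ae ?_
  filter_upwards [hf.coeFn_toLp] with x hx
  rw [RCLike.inner_apply, hx]

variable (Ω : Opens (EuclideanSpace ℝ (Fin d)))

/-- The derivative of a test function in a fixed direction, as a test function. -/
def testDeriv (φ : 𝓓(Ω, ℂ)) (v : EuclideanSpace ℝ (Fin d)) : 𝓓(Ω, ℂ) where
  toFun x := fderiv ℝ (φ : EuclideanSpace ℝ (Fin d) → ℂ) x v
  contDiff' := contDiff_fderiv_apply_const φ.contDiff v
  hasCompactSupport' := φ.hasCompactSupport.fderiv_apply ℝ v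
  tsupport_subset' := (tsupport_fderiv_apply_subset ℝ v).trans φ.tsupport_subset

variable {Ω}

lemma testFunction_eq_zero (φ : 𝓓(Ω, ℂ)) {x : EuclideanSpace ℝ (Fin d)}
    (hx : x ∉ (Ω : Set (EuclideanSpace ℝ (Fin d)))) : φ x = 0 :=
  image_eq_zero_of_notMem_tsupport fun h => hx (φ.tsupport_subset h)

lemma fderiv_conj_comp {f : EuclideanSpace ℝ (Fin d) → ℂ} (hf : ContDiff ℝ (⊤ : ℕ∞) f)
    (x v : EuclideanSpace ℝ (Fin d)) :
    fderiv ℝ (fun y => conj (f y)) x v = conj (fderiv ℝ f x v) := by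
  have h := ((Complex.conjCLE : ℂ →L[ℝ] ℂ).hasFDerivAt.comp x
    (hf.differentiable (by simp) x).hasFDerivAt).fderiv
  exact congrArg (fun L : EuclideanSpace ℝ (Fin d) →L[ℝ] ℂ => L v) h

/-- Each summand is a first partial of a test function, the form in which the weak gradient can be
applied. -/
lemma laplacian_testFunction (φ : 𝓓(Ω, ℂ)) (x : EuclideanSpace ℝ (Fin d)) :
    Laplacian.laplacian (φ : EuclideanSpace ℝ (Fin d) → ℂ) x =
      ∑ i, fderiv ℝ (testDeriv Ω φ (EuclideanSpace.single i 1) : EuclideanSpace ℝ (Fin d) → ℂ) x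
        (EuclideanSpace.single i 1) := by
  rw [InnerProductSpace.laplacian_eq_iteratedFDeriv_orthonormalBasis _
    (EuclideanSpace.basisFun (Fin d) ℝ)]
  refine Finset.sum_congr rfl fun i _ => ?_
  rw [iteratedFDeriv_two_apply]
  have hd : DifferentiableAt ℝ (fderiv ℝ (φ : EuclideanSpace ℝ (Fin d) → ℂ)) x :=
    ((φ.contDiff.fderiv_right (m := ((⊤ : ℕ∞) : WithTop ℕ∞)) (by simp)).differentiable (by simp)) x
  have h : fderiv ℝ (fun y => fderiv ℝ (φ : EuclideanSpace ℝ (Fin d) → ℂ) y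
      (EuclideanSpace.single i 1)) x (EuclideanSpace.single i 1) = _ :=
    congrArg (fun L : EuclideanSpace ℝ (Fin d) →L[ℝ] ℂ => L (EuclideanSpace.single i 1))
      (fderiv_clm_apply hd (differentiableAt_const (EuclideanSpace.single i (1 : ℝ))))
  refine Eq.trans ?_ h.symm
  simp

/-- The test function vanishes off `Ω`, so both integrals extend to the whole space, where
integration by parts has no boundary term. -/
lemma hasWeakPartial_of_contDiff {f : EuclideanSpace ℝ (Fin d) → ℂ} (hf : ContDiff ℝ (⊤ : ℕ∞) f)
    (hc : HasCompactSupport f) (i : Fin d) :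
    HasWeakPartial Ω i ((memLp_two_of_contDiff hf hc).toLp f)
      ((memLp_two_of_contDiff (contDiff_fderiv_apply_const hf (EuclideanSpace.single i 1))
        (hc.fderiv_apply ℝ _)).toLp _) := by
  intro φ
  set e : EuclideanSpace ℝ (Fin d) := EuclideanSpace.single i 1
  have hf' := contDiff_fderiv_apply_const hf e
  have hφ' := contDiff_fderiv_apply_const φ.contDiff e
  have e1 : ∫ x in (Ω : Set (EuclideanSpace ℝ (Fin d))),
      ((memLp_two_of_contDiff hf hc).toLp f : L2Ω Ω) x *
        fderiv ℝ (φ : EuclideanSpace ℝ (Fin d) → ℂ) x e =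
      ∫ x, f x * fderiv ℝ (φ : EuclideanSpace ℝ (Fin d) → ℂ) x e := by
    refine Eq.trans ?_ (setIntegral_eq_integral_of_forall_compl_eq_zero
      (s := (Ω : Set (EuclideanSpace ℝ (Fin d)))) ?_)
    · refine integral_congr_ae ?_
      filter_upwards [(memLp_two_of_contDiff (μ := volΩ Ω) hf hc).coeFn_toLp] with x hx
      rw [hx]
    · intro x hx
      rw [show fderiv ℝ (φ : EuclideanSpace ℝ (Fin d) → ℂ) x e = 0 from
        testFunction_eq_zero (testDeriv Ω φ e) hx, mul_zero]
  have e2 : ∫ x in (Ω : Set (EuclideanSpace ℝ (Fin d))),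
      ((memLp_two_of_contDiff hf' (hc.fderiv_apply ℝ e)).toLp _ : L2Ω Ω) x * φ x =
      ∫ x, fderiv ℝ f x e * φ x := by
    refine Eq.trans ?_ (setIntegral_eq_integral_of_forall_compl_eq_zero
      (s := (Ω : Set (EuclideanSpace ℝ (Fin d)))) ?_)
    · refine integral_congr_ae ?_
      filter_upwards [(memLp_two_of_contDiff (μ := volΩ Ω) hf' (hc.fderiv_apply ℝ e)).coeFn_toLp]
        with x hx
      rw [hx]
    · intro x hx
      rw [testFunction_eq_zero φ hx, mul_zero]
  rw [e1, e2]
  refine integral_mul_fderiv_eq_neg_fderiv_mul_of_integrable ?_ ?_ ?_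
    (fun x _ => hf.differentiable (by simp) x) (fun x _ => φ.contDiff.differentiable (by simp) x)
  · exact (hf'.continuous.mul φ.continuous).integrable_of_hasCompactSupport
      (φ.hasCompactSupport.mul_left)
  · exact (hf.continuous.mul hφ'.continuous).integrable_of_hasCompactSupport hc.mul_right
  · exact (hf.continuous.mul φ.continuous).integrable_of_hasCompactSupport hc.mul_right

/-- A smooth compactly supported function on `ℝ^d`, as an element of `H¹(Ω)`. -/
def H1.ofContDiff {f : EuclideanSpace ℝ (Fin d) → ℂ} (hf : ContDiff ℝ (⊤ : ℕ∞) f)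
    (hc : HasCompactSupport f) : H1 Ω :=
  ⟨WithLp.toLp 2 ((memLp_two_of_contDiff hf hc).toLp f, WithLp.toLp 2 fun i =>
    (memLp_two_of_contDiff (contDiff_fderiv_apply_const hf (EuclideanSpace.single i 1))
        (hc.fderiv_apply ℝ _)).toLp _), fun i => hasWeakPartial_of_contDiff hf hc i⟩

/-- A smooth compactly supported function on `ℝ^d`, as an element of `C(Ω̄) ∩ H¹(Ω)`. -/
def ContH1.ofContDiff [IsFiniteMeasure (σΓ Ω)] {f : EuclideanSpace ℝ (Fin d) → ℂ}
    (hf : ContDiff ℝ (⊤ : ℕ∞) f) (hc : HasCompactSupport f) : ContH1 Ω :=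
  ⟨(⟨fun x => f x, hf.continuous.comp continuous_subtype_val⟩, H1.ofContDiff hf hc,
    (memLp_two_of_contDiff hf hc).toLp f), by
      filter_upwards [(memLp_two_of_contDiff (μ := volΩ Ω) hf hc).coeFn_toLp] with x hx _ using hx, by
      filter_upwards [(memLp_two_of_contDiff (μ := σΓ Ω) hf hc).coeFn_toLp] with x hx _ using hx⟩

section Inner

variable [IsFiniteMeasure (σΓ Ω)] {f : EuclideanSpace ℝ (Fin d) → ℂ} (hf : ContDiff ℝ (⊤ : ℕ∞) f)
    (hc : HasCompactSupport f)

lemma inner_toL2_ofContDiff (u : L2Ω Ω) :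
    ⟪H1.toL2 (ContH1.toH1 (ContH1.ofContDiff hf hc : ContH1 Ω)), u⟫_ℂ
      = ∫ x in (Ω : Set (EuclideanSpace ℝ (Fin d))), u x * conj (f x) :=
  inner_toLp_left (memLp_two_of_contDiff hf hc) u

lemma inner_onΓ_ofContDiff (ψ : L2Γ Ω) :
    ⟪ContH1.onΓ (ContH1.ofContDiff hf hc : ContH1 Ω), ψ⟫_ℂ = ∫ x, ψ x * conj (f x) ∂(σΓ Ω) :=
  inner_toLp_left (memLp_two_of_contDiff hf hc) ψ

lemma inner_grad_ofContDiff (g : PiLp 2 (fun _ : Fin d => L2Ω Ω)) :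
    ⟪H1.grad (ContH1.toH1 (ContH1.ofContDiff hf hc : ContH1 Ω)), g⟫_ℂ
      = ∑ i, ∫ x in (Ω : Set (EuclideanSpace ℝ (Fin d))),
          g i x * conj (fderiv ℝ f x (EuclideanSpace.single i 1)) := by
  rw [PiLp.inner_apply]
  exact Finset.sum_congr rfl fun i _ => inner_toLp_left
    (memLp_two_of_contDiff (contDiff_fderiv_apply_const hf (EuclideanSpace.single i 1))
      (hc.fderiv_apply ℝ _)) (g i)

lemma inner_onΓ_ofContDiff_eq_zero (hs : tsupport f ⊆ (Ω : Set (EuclideanSpace ℝ (Fin d))))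
    (ψ : L2Γ Ω) : ⟪ContH1.onΓ (ContH1.ofContDiff hf hc : ContH1 Ω), ψ⟫_ℂ = 0 := by
  rw [inner_onΓ_ofContDiff]
  refine setIntegral_eq_zero_of_forall_eq_zero fun x hx => ?_
  have hxΩ : x ∉ (Ω : Set (EuclideanSpace ℝ (Fin d))) := fun h =>
    (Ω.isOpen.frontier_eq ▸ hx : x ∈ closure _ \ _).2 h
  rw [image_eq_zero_of_notMem_tsupport fun h => hxΩ (hs h), map_zero, mul_zero]

end Inner

/-! ### Weak derivatives are unique and closed -/

lemma l2Ω_eq_zero_of_integral_eq_zero {u : L2Ω Ω}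
    (h : ∀ f : EuclideanSpace ℝ (Fin d) → ℂ, ContDiff ℝ (⊤ : ℕ∞) f → HasCompactSupport f →
      tsupport f ⊆ (Ω : Set (EuclideanSpace ℝ (Fin d))) →
      ∫ x in (Ω : Set (EuclideanSpace ℝ (Fin d))), u x * f x = 0) : u = 0 := by
  have hloc : LocallyIntegrableOn u (Ω : Set (EuclideanSpace ℝ (Fin d))) volume :=
    locallyIntegrableOn_of_locallyIntegrable_restrict ((Lp.memLp u).locallyIntegrable (by norm_num))
  have h0 := Ω.isOpen.ae_eq_zero_of_integral_contDiff_smul_eq_zero hloc fun g hg hgc hgs => by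
    have h1 := h (fun x => (g x : ℂ)) (Complex.ofRealCLM.contDiff.comp hg)
      (hgc.comp_left Complex.ofReal_zero) ((closure_mono fun x hx => by
        simpa using hx).trans hgs)
    rw [← h1, ← setIntegral_eq_integral_of_forall_compl_eq_zero
      (s := (Ω : Set (EuclideanSpace ℝ (Fin d))))]
    · refine integral_congr_ae (Eventually.of_forall fun x => ?_)
      simp only [Complex.real_smul]
      rw [mul_comm]
    · intro x hx
      rw [image_eq_zero_of_notMem_tsupport fun h => hx (hgs h), zero_smul]
  rw [Lp.eq_zero_iff_ae_eq_zero]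
  exact (ae_restrict_iff' Ω.isOpen.measurableSet).2 h0

lemma l2Γ_eq_zero_of_integral_eq_zero [IsFiniteMeasure (σΓ Ω)] {ψ : L2Γ Ω}
    (h : ∀ f : EuclideanSpace ℝ (Fin d) → ℂ, ContDiff ℝ (⊤ : ℕ∞) f → HasCompactSupport f →
      ∫ x, ψ x * f x ∂(σΓ Ω) = 0) : ψ = 0 := by
  rw [Lp.eq_zero_iff_ae_eq_zero]
  refine ae_eq_zero_of_integral_contDiff_smul_eq_zero
    ((Lp.memLp ψ).locallyIntegrable (by norm_num)) fun g hg hgc => ?_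
  rw [← h (fun x => (g x : ℂ)) (Complex.ofRealCLM.contDiff.comp hg)
      (hgc.comp_left Complex.ofReal_zero)]
  refine integral_congr_ae (Eventually.of_forall fun x => ?_)
  simp only [Complex.real_smul]
  rw [mul_comm]

lemma HasWeakPartial.eq_zero {i : Fin d} {g : L2Ω Ω} (h : HasWeakPartial Ω i 0 g) : g = 0 := by
  refine l2Ω_eq_zero_of_integral_eq_zero fun f hf hc hs => ?_
  have h1 := h ⟨f, hf, hc, hs⟩
  rw [integral_eq_zero_of_ae, eq_comm, neg_eq_zero] at h1
  · exact h1
  · filter_upwards [Lp.coeFn_zero ℂ 2 (volΩ Ω)] with x hx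
    simp only [hx, Pi.zero_apply, zero_mul]

/-- Integration against a test function is the inner product with its conjugate, so every defining
equation is a closed condition. -/
lemma isClosed_H1 : IsClosed (H1 Ω : Set (L2Jet Ω)) := by
  have hset : (H1 Ω : Set (L2Jet Ω)) = ⋂ (i : Fin d) (φ : 𝓓(Ω, ℂ)), {p : L2Jet Ω |
      ∫ x in (Ω : Set (EuclideanSpace ℝ (Fin d))),
        p.fst x * fderiv ℝ (φ : EuclideanSpace ℝ (Fin d) → ℂ) x (EuclideanSpace.single i 1) =
      -∫ x in (Ω : Set (EuclideanSpace ℝ (Fin d))), p.snd i x * φ x} := by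
    ext p
    simp only [Set.mem_iInter]
    rfl
  have hint : ∀ φ : 𝓓(Ω, ℂ), Continuous fun u : L2Ω Ω =>
      ∫ x in (Ω : Set (EuclideanSpace ℝ (Fin d))), u x * φ x := fun φ => by
    have hm : MemLp (fun x => conj (φ x)) 2 (volΩ Ω) :=
      (Complex.continuous_conj.comp φ.continuous).memLp_of_hasCompactSupport
        (φ.hasCompactSupport.comp_left (map_zero _))
    have hi : Continuous fun u : L2Ω Ω => ⟪hm.toLp _, u⟫_ℂ := continuous_const.inner continuous_id
    refine hi.congr fun u => ?_
    rw [inner_toLp_left]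
    simp only [Complex.conj_conj]
  have hfst : Continuous fun p : L2Jet Ω => p.fst :=
    continuous_fst.comp (WithLp.prod_continuous_ofLp 2 _ _)
  have hsnd : Continuous fun p : L2Jet Ω => p.snd :=
    continuous_snd.comp (WithLp.prod_continuous_ofLp 2 _ _)
  rw [hset]
  refine isClosed_iInter fun i => isClosed_iInter fun φ => isClosed_eq ?_ ?_
  · exact (hint (testDeriv Ω φ (EuclideanSpace.single i 1))).comp hfst
  · exact ((hint φ).comp ((PiLp.continuous_apply 2 _ i).comp hsnd)).neg

end Smooth

/-! ### The Wentzell Laplacian as an operator associated with a form -/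

section Wentzell

variable {d : ℕ} {Ω : Opens (EuclideanSpace ℝ (Fin d))}

/-- Let `p` be orthogonal to the range. Smooth functions supported in `Ω` have zero boundary values
and force `p.fst = 0`; arbitrary smooth functions then force `p.snd = 0`. Conjugates are tested
because that slot of the inner product is antilinear. -/
lemma denseRange_wentzellJ [IsFiniteMeasure (σΓ Ω)] : DenseRange (wentzellJ Ω) := by
  have h : (LinearMap.range (wentzellJ Ω)).topologicalClosure = ⊤ := by
    rw [Submodule.topologicalClosure_eq_top_iff, Submodule.eq_bot_iff]
    intro p hp
    have hp' : ∀ v : ContH1 Ω, ⟪H1.toL2 (ContH1.toH1 v), p.fst⟫_ℂ + ⟪ContH1.onΓ v, p.snd⟫_ℂ = 0 :=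
      fun v => by
        have := (Submodule.mem_orthogonal _ p).1 hp (wentzellJ Ω v) ⟨v, rfl⟩
        rwa [WithLp.prod_inner_apply] at this
    have h1 : p.fst = 0 := by
      refine l2Ω_eq_zero_of_integral_eq_zero fun f hf hc hs => ?_
      have hf' : ContDiff ℝ (⊤ : ℕ∞) fun x => conj (f x) := Complex.conjCLE.contDiff.comp hf
      have hc' : HasCompactSupport fun x => conj (f x) := hc.comp_left (map_zero _)
      have hs' : tsupport (fun x => conj (f x)) ⊆ (Ω : Set (EuclideanSpace ℝ (Fin d))) :=
        (closure_mono fun x hx => by simpa using hx).trans hs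
      have := hp' (ContH1.ofContDiff hf' hc')
      rw [inner_onΓ_ofContDiff_eq_zero hf' hc' hs', add_zero, inner_toL2_ofContDiff] at this
      simpa only [Complex.conj_conj] using this
    have h2 : p.snd = 0 := by
      refine l2Γ_eq_zero_of_integral_eq_zero fun f hf hc => ?_
      have hf' : ContDiff ℝ (⊤ : ℕ∞) fun x => conj (f x) := Complex.conjCLE.contDiff.comp hf
      have hc' : HasCompactSupport fun x => conj (f x) := hc.comp_left (map_zero _)
      have := hp' (ContH1.ofContDiff hf' hc')
      rw [h1, inner_zero_right, zero_add, inner_onΓ_ofContDiff] at this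
      simpa only [Complex.conj_conj] using this
    exact (WithLp.ofLp_injective 2) (Prod.ext h1 h2)
  have h' := Submodule.dense_iff_topologicalClosure_eq_top.2 h
  rwa [LinearMap.coe_range] at h'

/-- The bounded operator `(f, φ) ↦ (0, β φ)`. -/
def boundaryMul (Ω : Opens (EuclideanSpace ℝ (Fin d))) (β : LinfΓ Ω) : HSum Ω →L[ℂ] HSum Ω :=
  LinearMap.mkContinuous
    { toFun := fun x => WithLp.toLp 2 (0, mulΓ Ω β x.snd)
      map_add' := fun x y => by
        refine (WithLp.ofLp_injective 2) (Prod.ext ?_ ?_)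
        · exact (add_zero (0 : L2Ω Ω)).symm
        · exact map_add (mulΓ Ω β) x.snd y.snd
      map_smul' := fun c x => by
        refine (WithLp.ofLp_injective 2) (Prod.ext ?_ ?_)
        · exact (smul_zero c).symm
        · exact map_smul (mulΓ Ω β) c x.snd } ‖β‖ fun x => by
    have h1 : ‖(WithLp.toLp 2 ((0 : L2Ω Ω), mulΓ Ω β x.snd) : HSum Ω)‖ = ‖mulΓ Ω β x.snd‖ := by
      simp
    have h2 : ‖x.snd‖ ≤ ‖x‖ := by
      refine (sq_le_sq₀ (norm_nonneg _) (norm_nonneg _)).1 ?_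
      rw [WithLp.prod_norm_sq_eq_of_L2]
      exact le_add_of_nonneg_left (sq_nonneg _)
    calc _ = ‖mulΓ Ω β x.snd‖ := h1
      _ ≤ ‖β‖ * ‖x.snd‖ := Lp.norm_smul_le β x.snd
      _ ≤ ‖β‖ * ‖x‖ := by gcongr

lemma inner_boundaryMul (β : LinfΓ Ω) (x y : HSum Ω) :
    ⟪x, boundaryMul Ω β y⟫_ℂ = ⟪x.snd, (β • y.snd : L2Γ Ω)⟫_ℂ := by
  rw [WithLp.prod_inner_apply]
  change ⟪x.fst, (0 : L2Ω Ω)⟫_ℂ + _ = _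
  rw [inner_zero_right, zero_add]
  rfl

lemma wentzellForm_eq (β : LinfΓ Ω) (u v : ContH1 Ω) :
    wentzellForm Ω β u v = ⟪ContH1.grad v, ContH1.grad u⟫_ℂ +
      ⟪wentzellJ Ω v, boundaryMul Ω β (wentzellJ Ω u)⟫_ℂ := by
  rw [inner_boundaryMul]
  rfl

/-- Convergence of `(j w, ∇w)` is `H¹` convergence together with `L²(Γ)` convergence of the boundary
values, which is how approximative traces are defined. Closedness of `H1 Ω` places the limit in
`H¹`. -/
lemma mem_formSpace_wentzell_iff {x : HSum Ω} {g : PiLp 2 (fun _ : Fin d => L2Ω Ω)} :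
    WithLp.toLp 2 (x, g) ∈ formSpace (wentzellJ Ω) (ContH1.grad (Ω := Ω)) ↔
      ∃ u : H1 Ω, H1.toL2 u = x.fst ∧ H1.grad u = g ∧ IsApproxTrace Ω u x.snd := by
  have hofLp := WithLp.prod_continuous_ofLp 2 (L2Ω Ω) (L2Γ Ω)
  have hofLp' := WithLp.prod_continuous_ofLp 2 (L2Ω Ω) (PiLp 2 (fun _ : Fin d => L2Ω Ω))
  rw [mem_formSpace_iff_seq]
  constructor
  · rintro ⟨w, h1, h2⟩
    have h3 := (hofLp.tendsto x).comp h1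
    have hfst : Tendsto (fun n => H1.toL2 (ContH1.toH1 (w n))) atTop (𝓝 x.fst) :=
      (continuous_fst.tendsto _).comp h3
    have hsnd : Tendsto (fun n => ContH1.onΓ (w n)) atTop (𝓝 x.snd) :=
      (continuous_snd.tendsto _).comp h3
    have hjet : Tendsto (fun n => (ContH1.toH1 (w n) : L2Jet Ω)) atTop
        (𝓝 (WithLp.toLp 2 (x.fst, g))) :=
      ((WithLp.prod_continuous_toLp 2 (L2Ω Ω) (PiLp 2 (fun _ : Fin d => L2Ω Ω))).tendsto
        (x.fst, g)).comp (hfst.prodMk_nhds h2)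
    exact ⟨⟨_, isClosed_H1.mem_of_tendsto hjet (Eventually.of_forall fun n =>
      (ContH1.toH1 (w n)).2)⟩, rfl, rfl, w, tendsto_subtype_rng.2 hjet, hsnd⟩
  · rintro ⟨u, hu, rfl, w, h1, h2⟩
    have h3 := (hofLp'.tendsto _).comp (tendsto_subtype_rng.1 h1)
    have hfst : Tendsto (fun n => H1.toL2 (ContH1.toH1 (w n))) atTop (𝓝 x.fst) := by
      rw [← hu]
      exact (continuous_fst.tendsto _).comp h3
    exact ⟨w, ((WithLp.prod_continuous_toLp 2 (L2Ω Ω) (L2Γ Ω)).tendsto (x.fst, x.snd)).comp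
      (hfst.prodMk_nhds h2), (continuous_snd.tendsto _).comp h3⟩

/-- Closability in `H`: the `L²(Ω)` component of the limit vanishes, and `g` is its weak gradient.
-/
lemma eq_zero_of_mem_formSpace_wentzell {g : PiLp 2 (fun _ : Fin d => L2Ω Ω)}
    (h : WithLp.toLp 2 ((0 : HSum Ω), g) ∈ formSpace (wentzellJ Ω) (ContH1.grad (Ω := Ω))) :
    g = 0 := by
  obtain ⟨u, h1, rfl, -⟩ := mem_formSpace_wentzell_iff.1 h
  refine PiLp.ext fun i => HasWeakPartial.eq_zero (i := i) ?_
  have h2 := u.2 i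
  rwa [show (u : L2Jet Ω).fst = 0 from h1] at h2

/-- Green's formula with a test function has no boundary term; the definition of the weak gradient
moves the remaining derivative onto the test function. -/
lemma hasWeakLaplacian_of_isNormalDeriv [IsFiniteMeasure (σΓ Ω)] {u : H1 Ω} {f : L2Ω Ω} {h : L2Γ Ω}
    (hu : IsNormalDeriv Ω u f h) : HasWeakLaplacian Ω (H1.toL2 u) f := by
  intro φ
  have hf' : ContDiff ℝ (⊤ : ℕ∞) fun x => conj (φ x) := Complex.conjCLE.contDiff.comp φ.contDiff
  have hc' : HasCompactSupport fun x => conj (φ x) := φ.hasCompactSupport.comp_left (map_zero _)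
  have hs' : tsupport (fun x => conj (φ x)) ⊆ (Ω : Set (EuclideanSpace ℝ (Fin d))) :=
    (closure_mono fun x hx => by simpa using hx).trans φ.tsupport_subset
  have h1 := hu (ContH1.ofContDiff hf' hc')
  rw [inner_onΓ_ofContDiff_eq_zero hf' hc' hs', inner_toL2_ofContDiff, inner_grad_ofContDiff] at h1
  simp only [fderiv_conj_comp φ.contDiff, Complex.conj_conj] at h1
  rw [eq_neg_of_add_eq_zero_left h1, ← Finset.sum_neg_distrib]
  simp only [laplacian_testFunction, Finset.mul_sum]
  rw [integral_finsetSum _ fun i _ => integrable_mul_fderiv_testFunction Ω _ _ _]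
  exact Finset.sum_congr rfl fun i _ => u.2 i (testDeriv Ω φ (EuclideanSpace.single i 1))

lemma wentzellRel_iff_mem_formGraph [IsFiniteMeasure (σΓ Ω)] (β : LinfΓ Ω) (x y : HSum Ω) :
    WentzellRel Ω β x y ↔
      (x, -y) ∈ formGraph (wentzellJ Ω) (ContH1.grad (Ω := Ω)) (boundaryMul Ω β) := by
  have hinner : ∀ (v : ContH1 Ω) (z : HSum Ω), ⟪wentzellJ Ω v, z⟫_ℂ
      = ⟪H1.toL2 (ContH1.toH1 v), z.fst⟫_ℂ + ⟪ContH1.onΓ v, z.snd⟫_ℂ := fun v z =>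
    WithLp.prod_inner_apply _ _
  rw [mem_formGraph]
  constructor
  · rintro ⟨u, h, hx, htr, -, hν, hy⟩
    refine ⟨H1.grad u, mem_formSpace_wentzell_iff.2 ⟨u, hx.symm, rfl, htr⟩, fun v => ?_⟩
    have h1 := hν v
    rw [inner_boundaryMul, inner_neg_right, hinner, hy, inner_sub_right, inner_neg_right, ← h1]
    change ⟪H1.grad (ContH1.toH1 v), H1.grad u⟫_ℂ + ⟪ContH1.onΓ v, (β • x.snd : L2Γ Ω)⟫_ℂ = _
    ring
  · rintro ⟨g, hg, h⟩
    obtain ⟨u, hx, rfl, htr⟩ := mem_formSpace_wentzell_iff.1 hg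
    -- The normal derivative is read off from the second component of `y = (Δu, -∂_ν u - β φ)`.
    have hν : IsNormalDeriv Ω u y.fst (-y.snd - (β • x.snd : L2Γ Ω)) := fun v => by
      have h1 : ⟪H1.grad (ContH1.toH1 v), H1.grad u⟫_ℂ + _ = _ := h v
      rw [inner_boundaryMul, inner_neg_right, hinner] at h1
      change _ + ⟪ContH1.onΓ v, (β • x.snd : L2Γ Ω)⟫_ℂ = _ at h1
      rw [eq_sub_of_add_eq h1, inner_sub_right, inner_neg_right]
      ring
    refine ⟨u, _, hx.symm, htr, hasWeakLaplacian_of_isNormalDeriv hν, hν, ?_⟩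
    abel

end Wentzell

end Wentzell

end

theorem theorem3p3 {d : ℕ} (hd : 1 ≤ d)
    (Ω : TopologicalSpace.Opens (EuclideanSpace ℝ (Fin d)))
    (hΩ : Bornology.IsBounded (Ω : Set (EuclideanSpace ℝ (Fin d))))
    (hσ : (μHE[d - 1] : Measure (EuclideanSpace ℝ (Fin d)))
      (frontier (Ω : Set (EuclideanSpace ℝ (Fin d)))) < ∞)
    (β : Wentzell.LinfΓ Ω) :
    ∃ A : Wentzell.HSum Ω →ₗ.[ℂ] Wentzell.HSum Ω,
      (∀ x y, (x, y) ∈ A.graph ↔ Wentzell.WentzellRel Ω β x y) ∧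
      (∃ S : ℝ≥0 → Wentzell.HSum Ω →L[ℂ] Wentzell.HSum Ω,
        Wentzell.IsHolomorphicC0Semigroup S ∧ Wentzell.IsGenerator A S) ∧
      Wentzell.IsSectorialForm (Wentzell.wentzellForm Ω β) (Wentzell.wentzellJ Ω) ∧
      (∀ x y, (x, -y) ∈ A.graph ↔
        Wentzell.FormOperatorRel (Wentzell.wentzellForm Ω β) (Wentzell.wentzellJ Ω) x y) := by
  have : IsFiniteMeasure (Wentzell.σΓ Ω) := ⟨by rwa [Measure.restrict_apply_univ]⟩
  obtain ⟨A, hA, hS⟩ := Wentzell.exists_generator_of_form (Wentzell.boundaryMul Ω β)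
    Wentzell.denseRange_wentzellJ fun g hg => Wentzell.eq_zero_of_mem_formSpace_wentzell hg
  refine ⟨A, fun x y => ?_, hS,
    Wentzell.isSectorialForm_of_bounded_perturbation Wentzell.denseRange_wentzellJ
      (Wentzell.wentzellForm_eq β), fun x y => ?_⟩
  · rw [hA, Wentzell.wentzellRel_iff_mem_formGraph]
  · rw [hA, neg_neg, Wentzell.formOperatorRel_iff_mem_formGraph (Wentzell.wentzellForm_eq β)]
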